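/- **Notation.** Let $\theta(z)=xz+4tz^3$ with $x,t\in\mathbb R$. For $D\subset\mathbb C$ put $D^\#=\{-\bar w: w\in D\}$ and $\overline D=\{\bar w: w\in D\}$. For a function $\alpha$ put $\alpha^\#(w)=\overline{\alpha(-\bar w)}$ and $\alpha^*(w)=\overline{\alpha(\bar w)}$. A species (breathers or solitons) that is absent has $N_\ell=0$ and $D_\ell=\emptyset$. **Soliton gas.** Let breathers fill a bounded open set $D_1\subset\mathbb C^+$ with density $\alpha_1$, and let solitons fill a bounded open set $D_2\subset\mathbb C^+$ with density $\alpha_2$. Put $U=D_1\cup D_1^\#\cup D_2$, $\gamma=\partial U$ and $\bar\gamma=\partial\overline U$. The gas Riemann–Hilbert problem asks for $M^\infty:\mathbb C\setminus(\gamma\cup\bar\gamma)\to SL_2(\mathbb C)$, analytic, with $M^\infty(z)=I+O(z^{-1})$ as $z\to\infty$, whose boundary values on $\gamma$ and $\bar\gamma$ satisfy $M^\infty_{\rm in}=M^\infty_{\rm out}V^\infty$. Here "in" means from $U$, respectively from $\overline U$, and "out" means from the complement of the closures of $U$ and $\overline U$. The jump matrix is $$V^\infty(z)=\begin{pmatrix}1&0\\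 \displaystyle\iint_{D_1}\frac{e^{2i\theta(w)}\alpha_1(w)}{w-z}\frac{d^2w}{\pi}-\iint_{D_1^\#}\frac{e^{2i\theta(w)}\alpha_1^\#(w)}{w-z}\frac{d^2w}{\pi}+\iint_{D_2}\frac{e^{2i\theta(w)}\alpha_2(w)}{w-z}\frac{d^2w}{\pi}&1\end{pmatrix},\quad z\in\gamma,$$ $$V^\infty(z)=\begin{pmatrix}1&\displaystyle\iint_{\overline{D_1}}\frac{e^{-2i\theta(w)}\alpha_1^*(w)}{z-w}\frac{d^2w}{\pi}-\iint_{\overline{D_1^\#}}\frac{e^{-2i\theta(w)}\alpha_1(-w)}{z-w}\frac{d^2w}{\pi}+\iint_{\overline{D_2}}\frac{e^{-2i\theta(w)}\alpha_2^*(w)}{z-w}\frac{d^2w}{\pi}\\0&1\end{pmatrix},\quad z\in\bar\gamma.$$ The gas solution (associated with the focusing mKdV equation $q_t+6q^2q_x+q_{xxx}=0$) is $q_\infty(x,t)=2i\lim_{|z|\to\infty}(zM^\infty(z))_{12}$. **Multi-soliton solution.** Let $(z_k,c_k)_{k=1}^{N_1}$ be breather data and $(\kappa_j,h_j)_{j=1}^{N_2}$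 soliton data, with $z_k,\kappa_j\in\mathbb C^+$ and $c_k,h_j\in\mathbb C$. The upper poles are the points $z_k$, $-\bar z_k$, $\kappa_j$, with norming constants $c_k$, $-\bar c_k$, $h_j$. If some of these points coincide, their constants are added; $C_p$ denotes the resulting constant at $p$. The Riemann–Hilbert problem asks for $M$ with values in $SL_2(\mathbb C)$, analytic off the points $p,\bar p$, with $M(z)=I+O(z^{-1})$ as $z\to\infty$, with at most simple poles, and with $$\operatorname*{Res}_{z=p}M=\lim_{z\to p}M(z)\begin{pmatrix}0&0\\C_pe^{2i\theta(p)}&0\end{pmatrix},\qquad \operatorname*{Res}_{z=\bar p}M=\lim_{z\to\bar p}M(z)\begin{pmatrix}0&-\overline{C_p}\,e^{-2i\theta(\bar p)}\\0&0\end{pmatrix}$$ for every upper pole $p$. The multi-soliton solution is $q_N(x,t)=2i\lim_{|z|\to\infty}(zM(z))_{12}$. **Theorem.** Let $N_1,N_2\ge 0$ be integers, $d_0\in\mathbb C^+$, $d_1\in\mathbb C\setminus\{0\}$ and $\rho>0$. For $\ell=1,2$ let $$D_\ell=\{z\in\mathbb C:\ |(z-d_0)^{N_\ell}-d_1|<\rho\}\quad(D_\ell=\emptyset\text{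 if }N_\ell=0),$$ and suppose $D_\ell\subset\mathbb C^+$. (For $N_1=N_2=m$ this is a single quadrature domain $D$.) Let $\varpi_\ell$ be analytic in $D_\ell$ and continuous on its closure, and let $\alpha_\ell(z)=N_\ell(\bar z-\bar d_0)^{N_\ell-1}\varpi_\ell(z)$. Let $z_1,\dots,z_{N_1}$ be the distinct roots of $(z-d_0)^{N_1}=d_1$ and $\kappa_1,\dots,\kappa_{N_2}$ the distinct roots of $(z-d_0)^{N_2}=d_1$ (no roots when $N_\ell=0$). Then the gas solution $q_\infty(x,t)$ of $(D_1,\alpha_1;D_2,\alpha_2)$ exists and is unique for all real $x,t$, and it coincides with the multi-soliton solution with breather data $(z_k,c_k)$ and soliton data $(\kappa_j,h_j)$, where $$c_k=\frac{\rho^2\varpi_1(z_k)}{\prod_{s\ne k}(z_k-z_s)},\qquad h_j=\frac{\rho^2\varpi_2(\kappa_j)}{\prod_{s\ne j}(\kappa_j-\kappa_s)} .$$ -/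

import Mathlib

open scoped ComplexConjugate

noncomputable section

namespace MKdVGas

open Filter Topology

/-- The open upper half-plane. -/
def upperHalf : Set ℂ := {z | 0 < z.im}

/-- The phase `θ(z) = x z + 4 t z³`. -/
def phase (x t : ℝ) (z : ℂ) : ℂ := (x : ℂ) * z + 4 * (t : ℂ) * z ^ 3

/-- The quadrature domain `{z : |(z - d₀)^m - d₁| < ρ}`. The value `m = 0` encodes an absent
species, and then the domain is empty. -/
def quadratureDomain (m : ℕ) (d₀ d₁ : ℂ) (ρ : ℝ) : Set ℂ :=
  {z | 0 < m ∧ ‖(z - d₀) ^ m - d₁‖ < ρ}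

/-- The density `α(z, z̄) = N (z̄ - d̄₀)^(N-1) ϖ(z)`. -/
def density (N : ℕ) (d₀ : ℂ) (ϖ : ℂ → ℂ) (z : ℂ) : ℂ :=
  (N : ℂ) * (conj z - conj d₀) ^ (N - 1) * ϖ z

/-- The image of `D` under the reflection `z ↦ -z̄` in the imaginary axis. -/
def mirror (D : Set ℂ) : Set ℂ := {w | -conj w ∈ D}

/-- The image of `D` under complex conjugation. -/
def conjSet (D : Set ℂ) : Set ℂ := {w | conj w ∈ D}

/-! ### Normalised 2 × 2 matrices, and the potential they define -/

/-- `M` takes values in `SL₂(ℂ)` and is analytic off `Γ`, and `M(z) = I + O(1/z)` as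
`z → ∞`. -/
structure IsNormalized (Γ : Set ℂ) (M : ℂ → Matrix (Fin 2) (Fin 2) ℂ) : Prop where
  analytic : ∀ i j, DifferentiableOn ℂ (fun z => M z i j) Γᶜ
  det_eq_one : ∀ z ∈ Γᶜ, (M z).det = 1
  asymptotics : ∀ i j,
    (fun z => M z i j - (1 : Matrix (Fin 2) (Fin 2) ℂ) i j) =O[Bornology.cobounded ℂ]
      (fun z => z⁻¹)

/-- `q = 2 i lim_{|z| → ∞} (z M(z))₁₂`. -/
def HasPotential (M : ℂ → Matrix (Fin 2) (Fin 2) ℂ) (q : ℂ) : Prop :=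
  Tendsto (fun z => 2 * Complex.I * (z * M z 0 1)) (Bornology.cobounded ℂ) (𝓝 q)

/-! ### The soliton gas

A gas consists of breathers filling `D₁` with density `α₁` (a breather at `w` comes with its mirror
pole `-w̄`, whose norming constant is minus the conjugate), and of solitons filling `D₂` with
density `α₂`. -/

/-- The region of the upper half-plane that the spectrum fills: breathers, mirror poles,
solitons. The contour `γ` is its boundary. -/
def gasRegion (D₁ D₂ : Set ℂ) : Set ℂ := D₁ ∪ mirror D₁ ∪ D₂

/-- `∬_D e^{2iθ(w)} α(w) / (w - z) d²w / π`. -/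
def upperTransform (x t : ℝ) (D : Set ℂ) (α : ℂ → ℂ) (z : ℂ) : ℂ :=
  (∫ w in D, Complex.exp (2 * Complex.I * phase x t w) * α w / (w - z)) / (Real.pi : ℂ)

/-- `∬_E e^{-2iθ(w)} β(w) / (z - w) d²w / π`. -/
def lowerTransform (x t : ℝ) (E : Set ℂ) (β : ℂ → ℂ) (z : ℂ) : ℂ :=
  (∫ w in E, Complex.exp (-(2 * Complex.I * phase x t w)) * β w / (z - w)) / (Real.pi : ℂ)

/-- The jump matrix on `γ`. If `D₁ = D₂ = D` and `D` is symmetric with respect to the imaginary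
axis, its lower left entry is
`∬_D e^{2iθ(w)} (α₁(w) - conj α₁(-w̄) + α₂(w)) / (w - z) d²w / π`. -/
def upperJump (x t : ℝ) (D₁ : Set ℂ) (α₁ : ℂ → ℂ) (D₂ : Set ℂ) (α₂ : ℂ → ℂ) (z : ℂ) :
    Matrix (Fin 2) (Fin 2) ℂ :=
  !![1, 0;
     upperTransform x t D₁ α₁ z
       - upperTransform x t (mirror D₁) (fun w => conj (α₁ (-conj w))) z
       + upperTransform x t D₂ α₂ z, 1]

/-- The jump matrix on `γ̄`. -/
def lowerJump (x t : ℝ) (D₁ : Set ℂ) (α₁ : ℂ → ℂ) (D₂ : Set ℂ) (α₂ : ℂ → ℂ) (z : ℂ) :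
    Matrix (Fin 2) (Fin 2) ℂ :=
  !![1, lowerTransform x t (conjSet D₁) (fun w => conj (α₁ (conj w))) z
       - lowerTransform x t (conjSet (mirror D₁)) (fun w => α₁ (-w)) z
       + lowerTransform x t (conjSet D₂) (fun w => conj (α₂ (conj w))) z;
     0, 1]

/-- At every point of the boundary of `U`, `M` has a boundary value `A` from `U` and a boundary
value `B` from the open set `W`, and `A = B V`. -/
def HasJump (U W : Set ℂ) (V M : ℂ → Matrix (Fin 2) (Fin 2) ℂ) : Prop :=
  ∀ s ∈ frontier U, ∃ A B : Matrix (Fin 2) (Fin 2) ℂ,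
    Tendsto M (𝓝[U] s) (𝓝 A) ∧ Tendsto M (𝓝[W] s) (𝓝 B) ∧ A = B * V s

/-- The Riemann-Hilbert problem of the gas. On `γ` and on `γ̄` the boundary value from the
bounded region that the curve encloses is the boundary value from outside times the jump
matrix. -/
structure IsGasRHSolution (x t : ℝ) (D₁ : Set ℂ) (α₁ : ℂ → ℂ) (D₂ : Set ℂ) (α₂ : ℂ → ℂ)
    (M : ℂ → Matrix (Fin 2) (Fin 2) ℂ) : Prop where
  normalized : IsNormalized
    (frontier (gasRegion D₁ D₂) ∪ frontier (conjSet (gasRegion D₁ D₂))) M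
  jump_upper : HasJump (gasRegion D₁ D₂)
    (closure (gasRegion D₁ D₂) ∪ closure (conjSet (gasRegion D₁ D₂)))ᶜ
    (upperJump x t D₁ α₁ D₂ α₂) M
  jump_lower : HasJump (conjSet (gasRegion D₁ D₂))
    (closure (gasRegion D₁ D₂) ∪ closure (conjSet (gasRegion D₁ D₂)))ᶜ
    (lowerJump x t D₁ α₁ D₂ α₂) M

/-- `q` is the gas solution `q_∞`. -/
def IsGasSolution (D₁ : Set ℂ) (α₁ : ℂ → ℂ) (D₂ : Set ℂ) (α₂ : ℂ → ℂ) (q : ℝ → ℝ → ℂ) : Prop :=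
  ∀ x t : ℝ, ∃ M, IsGasRHSolution x t D₁ α₁ D₂ α₂ M ∧ HasPotential M (q x t)

/-! ### Finitely many solitons and breathers -/

/-- The poles in the upper half-plane: `z_k`, `-z̄_k` for the breathers, `κ_j` for the solitons. -/
def upperPoles {N₁ N₂ : ℕ} (z : Fin N₁ → ℂ) (κ : Fin N₂ → ℂ) : Set ℂ :=
  Set.range z ∪ Set.range (fun k => -conj (z k)) ∪ Set.range κ

open Classical in
/-- The norming constant at the pole `p`: `c_k` at `z_k`, `-c̄_k` at `-z̄_k`, `h_j` at `κ_j`.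
At a point that is named several times the constants are added. -/
def normingConstant {N₁ N₂ : ℕ} (z c : Fin N₁ → ℂ) (κ h : Fin N₂ → ℂ) (p : ℂ) : ℂ :=
  (∑ k, if z k = p then c k else 0)
    - (∑ k, if -conj (z k) = p then conj (c k) else 0)
    + ∑ j, if κ j = p then h j else 0

/-- `M` has at most a simple pole at `p`, and `Res_{z = p} M = lim_{z → p} M(z) R`. -/
def HasResidueCondition (p : ℂ) (R : Matrix (Fin 2) (Fin 2) ℂ)
    (M : ℂ → Matrix (Fin 2) (Fin 2) ℂ) : Prop :=
  ∃ A : Matrix (Fin 2) (Fin 2) ℂ,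
    Tendsto (fun z => (z - p) • M z) (𝓝[≠] p) (𝓝 A) ∧
    Tendsto (fun z => M z * R) (𝓝[≠] p) (𝓝 A)

/-- The Riemann-Hilbert problem of the breathers `(z_k, c_k)` and the solitons `(κ_j, h_j)`. -/
structure IsSolitonRHSolution (x t : ℝ) {N₁ N₂ : ℕ} (z c : Fin N₁ → ℂ) (κ h : Fin N₂ → ℂ)
    (M : ℂ → Matrix (Fin 2) (Fin 2) ℂ) : Prop where
  normalized : IsNormalized (upperPoles z κ ∪ conjSet (upperPoles z κ)) M
  residue_upper : ∀ p ∈ upperPoles z κ, HasResidueCondition p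
    !![0, 0; normingConstant z c κ h p * Complex.exp (2 * Complex.I * phase x t p), 0] M
  residue_lower : ∀ p ∈ upperPoles z κ, HasResidueCondition (conj p)
    !![0, -(conj (normingConstant z c κ h p)
        * Complex.exp (-(2 * Complex.I * phase x t (conj p)))); 0, 0] M

/-- `q` is the multi-soliton solution `q_N` with these spectral data. -/
def IsSolitonSolution {N₁ N₂ : ℕ} (z c : Fin N₁ → ℂ) (κ h : Fin N₂ → ℂ) (q : ℝ → ℝ → ℂ) : Prop :=
  ∀ x t : ℝ, ∃ M, IsSolitonRHSolution x t z c κ h M ∧ HasPotential M (q x t)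

/-- The norming constants `ρ² ϖ(z_k) / ∏_{s ≠ k} (z_k - z_s)`. -/
def shieldedConstant {N : ℕ} (ρ : ℝ) (ϖ : ℂ → ℂ) (z : Fin N → ℂ) (k : Fin N) : ℂ :=
  (ρ : ℂ) ^ 2 * ϖ (z k) / ∏ s ∈ Finset.univ.erase k, (z k - z s)

end MKdVGas

end

/-!
The idea is to shrink the spectrum to points. On the contour the jump matrix is triangular, and its
nontrivial entry is the Cauchy transform of the density over the quadrature domain. The density is
`conj (P') ϖ` with `P = (z - d₀)^N - d₁`, so the quadrature identity (`setIntegral_conj_pow_mul`,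
`upperTransform_density`) evaluates the transform off the domain: it is that of `N` point masses at
the roots of `P`. Averaging over the rotations by `N`-th roots of unity makes the integrand a
function of `ζ = (z - d₀)^N`, and the identity becomes the mean value property in the disc
`|ζ - d₁| < ρ`; for points on the boundary of the domain one exhausts it by smaller ones.

Hence the jump is a rational function whose poles are the soliton poles, and it continues into the
spectrum as the triangular factor `gasFactor`. Multiplying by this factor inside the spectrum, and
dividing by it, passes between the two Riemann-Hilbert problems without changing the potential. A
residue condition says exactly that the product with the factor has a limit at the pole
(`hasResidueCondition_iff`). Conversely, dividing by the factor makes a solution of the jump problem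
continuous across the contour, and continuity implies holomorphy there: the contour lies on finitely
many lemniscates `|P| = ρ`, which are, off finitely many points, locally biholomorphic images of a
line, and a line is removable for continuous functions by Morera's theorem
(`contRemovable_lemniscate`). The domains may touch the real line; the contour meets it in a finite
set, so the limits of the upper and the lower jump conditions at such a point still agree.

The pole problem has exactly one solution. Uniqueness is Liouville's theorem for the quotient of two
solutions. Existence reduces to a square linear system for the residues, whose homogeneous version
has only the zero solution `(X₁, X₂)`, since the residue conditions cancel all terms in the partial
fraction expansion of `|X₁|² + |X₂|²` on the real line (`homogeneous_eq_zero`).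
-/

noncomputable section

namespace MKdVGas

open Filter Topology

/-! ### Sets removable for continuous functions -/

/-- The set `{w : ‖(w - a)^N - b‖ = ρ}`, which carries the boundary of a quadrature domain. -/
def lemniscate (N : ℕ) (a b : ℂ) (ρ : ℝ) : Set ℂ := {w | ‖(w - a) ^ N - b‖ = ρ}

/-- A closed set that is removable for continuous functions: a function that is continuous on an
open set and holomorphic off `K` is holomorphic. The requirement that `K` meet every horizontal
line in a finite set makes its complement dense, and even dense along every such line. -/
structure ContRemovable (K : Set ℂ) : Prop where
  isClosed : IsClosed K
  line_finite : ∀ s : ℂ, {x : ℝ | s + x ∈ K}.Finite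
  differentiableOn : ∀ (Ω : Set ℂ) (f : ℂ → ℂ), IsOpen Ω → ContinuousOn f Ω →
    DifferentiableOn ℂ f (Ω \ K) → DifferentiableOn ℂ f Ω

namespace ContRemovable

lemma mono {K L : Set ℂ} (hL : ContRemovable L) (hK : IsClosed K) (h : K ⊆ L) :
    ContRemovable K where
  isClosed := hK
  line_finite s := (hL.line_finite s).subset fun _ hx => h hx
  differentiableOn Ω f hΩ hc hd :=
    hL.differentiableOn Ω f hΩ hc (hd.mono (Set.sdiff_subset_sdiff_right h))

lemma union {K L : Set ℂ} (hK : ContRemovable K) (hL : ContRemovable L) :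
    ContRemovable (K ∪ L) where
  isClosed := hK.isClosed.union hL.isClosed
  line_finite s := ((hK.line_finite s).union (hL.line_finite s)).subset fun _ hx => hx
  differentiableOn Ω f hΩ hc hd := by
    refine hL.differentiableOn Ω f hΩ hc ?_
    refine hK.differentiableOn (Ω \ L) f (hΩ.sdiff hL.isClosed) (hc.mono Set.sdiff_subset) ?_
    exact hd.mono fun z hz => ⟨hz.1.1, fun h => h.elim hz.2 hz.1.2⟩

lemma empty : ContRemovable ∅ where
  isClosed := isClosed_empty
  line_finite s := by simp
  differentiableOn Ω f hΩ hc hd := by simpa using hd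

lemma singleton (p : ℂ) : ContRemovable {p} where
  isClosed := isClosed_singleton
  line_finite s := by
    refine Set.Subsingleton.finite fun x hx y hy => ?_
    have hx' : s + x = p := hx
    have hy' : s + y = p := hy
    exact_mod_cast add_left_cancel (hx'.trans hy'.symm)
  differentiableOn Ω f hΩ hc hd := by
    by_cases hp : p ∈ Ω
    · exact (Complex.differentiableOn_compl_singleton_and_continuousAt_iff (hΩ.mem_nhds hp)).1
        ⟨hd, hc.continuousAt (hΩ.mem_nhds hp)⟩
    · rwa [Set.sdiff_singleton_eq_self hp] at hd

lemma of_finite {K : Set ℂ} (hK : K.Finite) : ContRemovable K := by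
  induction K, hK using Set.Finite.induction_on with
  | empty => exact empty
  | insert _ _ ih => exact (singleton _).union ih

/-- The complement of a removable set is dense along horizontal lines. -/
lemma mem_closure_line {K : Set ℂ} (hK : ContRemovable K) (s : ℂ) :
    s ∈ closure ((fun x : ℝ => s + x) '' {x : ℝ | s + x ∉ K}) := by
  have hd : Dense {x : ℝ | s + x ∈ K}ᶜ := (hK.line_finite s).countable.dense_compl ℝ
  have hc : Continuous fun x : ℝ => s + (x : ℂ) := by fun_prop
  have := image_closure_subset_closure_image hc (Set.mem_image_of_mem _ (hd 0))
  rwa [Complex.ofReal_zero, add_zero] at this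

lemma dense_compl {K : Set ℂ} (hK : ContRemovable K) : Dense Kᶜ := fun s => by
  refine closure_mono ?_ (hK.mem_closure_line s)
  rintro _ ⟨x, hx, rfl⟩
  exact hx

/-- A holomorphic function that has limits at the points of a removable set extends
holomorphically over it. -/
lemma extend {K Ω : Set ℂ} (hK : ContRemovable K) (hΩ : IsOpen Ω) {f : ℂ → ℂ}
    (hd : DifferentiableOn ℂ f (Ω \ K))
    (hl : ∀ s ∈ Ω ∩ K, ∃ y, Tendsto f (𝓝[Kᶜ] s) (𝓝 y)) :
    DifferentiableOn ℂ (extendFrom Kᶜ f) Ω ∧ ∀ z ∈ Ω \ K, extendFrom Kᶜ f z = f z := by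
  have hopen : IsOpen (Ω \ K) := hΩ.sdiff hK.isClosed
  have hev : ∀ z ∈ Ω \ K, extendFrom Kᶜ f z = f z := fun z hz =>
    extendFrom_eq (hK.dense_compl z)
      ((hd.differentiableAt (hopen.mem_nhds hz)).continuousAt.tendsto.mono_left
        nhdsWithin_le_nhds)
  have hcont : ContinuousOn (extendFrom Kᶜ f) Ω := by
    refine continuousOn_extendFrom (fun z _ => hK.dense_compl z) fun z hz => ?_
    by_cases hzK : z ∈ K
    · exact hl z ⟨hz, hzK⟩
    · exact ⟨f z, (hd.differentiableAt (hopen.mem_nhds ⟨hz, hzK⟩)).continuousAt.tendsto.mono_left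
        nhdsWithin_le_nhds⟩
  exact ⟨hK.differentiableOn Ω _ hΩ hcont (hd.congr hev), hev⟩

end ContRemovable

/-- A continuous function on a disc that is holomorphic off the imaginary axis is holomorphic. -/
lemma differentiableOn_ball_of_re_ne_zero {g : ℂ → ℂ} {c : ℂ} {r : ℝ}
    (hc : ContinuousOn g (Metric.ball c r))
    (hd : DifferentiableOn ℂ g (Metric.ball c r \ {w | w.re = 0})) :
    DifferentiableOn ℂ g (Metric.ball c r) := by
  refine (Complex.isConservativeOn_and_continuousOn_iff_isDifferentiableOn
    Metric.isOpen_ball).1 ⟨fun z w hzw => ?_, hc⟩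
  rw [← add_eq_zero_iff_eq_neg, Complex.wedgeIntegral_add_wedgeIntegral_eq]
  -- Cauchy-Goursat for a rectangle whose interior avoids the imaginary axis
  have key : ∀ a b : ℝ, Set.uIcc a b ⊆ Set.uIcc z.re w.re →
      (0 : ℝ) ∉ Set.Ioo (min a b) (max a b) →
      (∫ x : ℝ in a..b, g (x + z.im * Complex.I)) - (∫ x : ℝ in a..b, g (x + w.im * Complex.I)) +
        Complex.I • (∫ y : ℝ in z.im..w.im, g (b + y * Complex.I)) -
        Complex.I • (∫ y : ℝ in z.im..w.im, g (a + y * Complex.I)) = 0 := by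
    intro a b hab h0
    have hsub : (Set.uIcc a b ×ℂ Set.uIcc z.im w.im) ⊆ Metric.ball c r := fun u hu =>
      hzw (show u ∈ Set.uIcc z.re w.re ×ℂ Set.uIcc z.im w.im from ⟨hab hu.1, hu.2⟩)
    have := Complex.integral_boundary_rect_eq_zero_of_continuousOn_of_differentiableOn g
      ⟨a, z.im⟩ ⟨b, w.im⟩ (hc.mono hsub) (hd.mono ?_)
    · simpa using this
    · intro u hu
      refine ⟨hsub ⟨Set.Ioo_subset_Icc_self hu.1, Set.Ioo_subset_Icc_self hu.2⟩, fun h => h0 ?_⟩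
      have h1 := hu.1
      rw [Set.mem_preimage, show u.re = 0 from h] at h1
      exact h1
  by_cases h0 : (0 : ℝ) ∈ Set.Ioo (min z.re w.re) (max z.re w.re)
  · have h0' : (0 : ℝ) ∈ Set.uIcc z.re w.re := Set.Ioo_subset_Icc_self h0
    have h1 := key z.re 0 (Set.uIcc_subset_uIcc_left h0') (by
      rintro ⟨h1, h2⟩
      rcases le_total z.re 0 with h | h <;> simp_all)
    have h2 := key 0 w.re (Set.uIcc_subset_uIcc_right h0') (by
      rintro ⟨h1, h2⟩
      rcases le_total w.re 0 with h | h <;> simp_all)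
    have hint : ∀ v ∈ Set.uIcc z.im w.im, ∀ a ∈ Set.uIcc z.re w.re, ∀ b ∈ Set.uIcc z.re w.re,
        IntervalIntegrable (fun x : ℝ => g (x + v * Complex.I)) MeasureTheory.volume a b := by
      intro v hv a ha b hb
      refine ContinuousOn.intervalIntegrable (hc.comp (by fun_prop) fun x hx => hzw ?_)
      exact ⟨by simpa using Set.uIcc_subset_uIcc ha hb hx, by simpa using hv⟩
    have hz := Set.left_mem_uIcc (a := z.re) (b := w.re)
    have hw := Set.right_mem_uIcc (a := z.re) (b := w.re)
    rw [← intervalIntegral.integral_add_adjacent_intervals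
        (hint z.im Set.left_mem_uIcc _ hz _ h0') (hint z.im Set.left_mem_uIcc _ h0' _ hw),
      ← intervalIntegral.integral_add_adjacent_intervals
        (hint w.im Set.right_mem_uIcc _ hz _ h0') (hint w.im Set.right_mem_uIcc _ h0' _ hw)]
    linear_combination h1 + h2
  · exact key z.re w.re subset_rfl h0

/-- Removability is a local biholomorphic notion: near a zero of `h` where `h' ≠ 0`, a continuous
function that is holomorphic off `{Re h = 0}` is holomorphic. -/
lemma differentiableAt_of_re_ne_zero {f h : ℂ → ℂ} {s : ℂ} {Ω : Set ℂ} (hΩ : Ω ∈ 𝓝 s)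
    (hh : AnalyticAt ℂ h s) (hh' : deriv h s ≠ 0) (hc : ContinuousOn f Ω)
    (hd : ∀ w ∈ Ω, (h w).re ≠ 0 → DifferentiableAt ℂ f w) : DifferentiableAt ℂ f s := by
  have hsd : HasStrictDerivAt h (deriv h s) s := hh.hasStrictDerivAt
  set g := hsd.localInverse h (deriv h s) s hh' with hg
  have hgan : AnalyticAt ℂ g (h s) := hh.analyticAt_localInverse hh'
  have hgs : g (h s) = s := (hsd.eventually_left_inverse hh').self_of_nhds
  have hΩi : interior Ω ∈ 𝓝 (g (h s)) := by rw [hgs]; exact interior_mem_nhds.2 hΩ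
  have hev : ∀ᶠ x in 𝓝 (h s), AnalyticAt ℂ g x ∧ h (g x) = x ∧ g x ∈ interior Ω :=
    hgan.eventually_analyticAt.and ((hsd.eventually_right_inverse hh').and
      (hgan.continuousAt.eventually_mem hΩi))
  obtain ⟨δ, hδ, hball⟩ := Metric.eventually_nhds_iff_ball.1 hev
  have hD : DifferentiableOn ℂ (f ∘ g) (Metric.ball (h s) δ) := by
    refine differentiableOn_ball_of_re_ne_zero ?_ ?_
    · exact hc.comp (fun x hx => (hball x hx).1.continuousAt.continuousWithinAt)
        fun x hx => interior_subset (hball x hx).2.2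
    · rintro x ⟨hx, hx0⟩
      refine (DifferentiableAt.comp x (hd _ (interior_subset (hball x hx).2.2) ?_)
        (hball x hx).1.differentiableAt).differentiableWithinAt
      rwa [(hball x hx).2.1]
  have hfs : f =ᶠ[𝓝 s] (f ∘ g) ∘ h := by
    filter_upwards [hsd.eventually_left_inverse hh'] with w hw
    simp [hg, hw]
  refine DifferentiableAt.congr_of_eventuallyEq ?_ hfs
  exact (hD.differentiableAt (Metric.ball_mem_nhds _ hδ)).comp s hh.differentiableAt

lemma isClosed_lemniscate (N : ℕ) (a b : ℂ) (ρ : ℝ) : IsClosed (lemniscate N a b ρ) :=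
  isClosed_eq (by fun_prop) continuous_const

open Polynomial in
/-- On a horizontal line, `‖(w - a)^N - b‖² - ρ²` is a polynomial of degree `2N`. -/
lemma lemniscate_line_finite {N : ℕ} (hN : 0 < N) (a b : ℂ) (ρ : ℝ) (s : ℂ) :
    {x : ℝ | s + x ∈ lemniscate N a b ρ}.Finite := by
  set A : ℂ → ℂ → ℂ[X] := fun u v => (X - C u) ^ N - C v
  have hA : ∀ u v, (A u v).natDegree = N := fun u v => by
    simp only [A]
    rw [natDegree_sub_C]
    simp [natDegree_pow]
  set Q : ℂ[X] := A (a - s) b * A (conj (a - s)) (conj b) - C ((ρ : ℂ) ^ 2)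
  have hA0 : ∀ u v, A u v ≠ 0 := fun u v h => by
    have := hA u v
    rw [h, natDegree_zero] at this
    omega
  have hQ : Q ≠ 0 := by
    intro h
    have : Q.natDegree = N + N := by
      simp only [Q]
      rw [natDegree_sub_C, natDegree_mul (hA0 _ _) (hA0 _ _), hA, hA]
    rw [h, natDegree_zero] at this
    omega
  refine Set.Finite.subset (s := (fun x : ℝ => (x : ℂ)) ⁻¹' (Q.roots.toFinset : Set ℂ)) ?_ ?_
  · exact (Finset.finite_toSet _).preimage Complex.ofReal_injective.injOn
  · intro x hx
    have hx' : ‖(s + x - a) ^ N - b‖ = ρ := hx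
    simp only [Set.mem_preimage, SetLike.mem_coe, Multiset.mem_toFinset]
    rw [mem_roots hQ, IsRoot]
    have h1 : (s + x - a) ^ N - b = ((x : ℂ) - (a - s)) ^ N - b := by ring_nf
    have h2 : conj ((s + x - a) ^ N - b) = ((x : ℂ) - conj (a - s)) ^ N - conj b := by
      rw [h1]; simp
    simp only [Q, A, eval_sub, eval_mul, eval_pow, eval_X, eval_C]
    rw [← h2, ← h1, Complex.mul_conj, Complex.normSq_eq_norm_sq, hx']
    simp

lemma contRemovable_lemniscate {N : ℕ} (hN : 0 < N) (a b : ℂ) {ρ : ℝ} (hρ : 0 < ρ) :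
    ContRemovable (lemniscate N a b ρ) where
  isClosed := isClosed_lemniscate N a b ρ
  line_finite := lemniscate_line_finite hN a b ρ
  differentiableOn := by
    intro Ω f hΩ hc hd
    refine (ContRemovable.singleton a).differentiableOn Ω f hΩ hc fun s hs => ?_
    refine DifferentiableAt.differentiableWithinAt ?_
    by_cases hsK : s ∈ lemniscate N a b ρ
    swap
    · exact hd.differentiableAt
        ((hΩ.sdiff (isClosed_lemniscate N a b ρ)).mem_nhds ⟨hs.1, hsK⟩)
    have hsa : s - a ≠ 0 := sub_ne_zero.2 hs.2
    set P : ℂ → ℂ := fun w => (w - a) ^ N - b with hP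
    have hPs : ‖P s‖ = ρ := hsK
    have hPs0 : P s ≠ 0 := by
      intro h; rw [h, norm_zero] at hPs; exact hρ.ne hPs
    have hPd : HasDerivAt P (N * (s - a) ^ (N - 1)) s := by
      have := (((hasDerivAt_id s).sub_const a).pow N).sub_const b
      simp only [id, mul_one] at this
      exact this
    -- `Re h = log (‖P‖ / ρ)`
    set h : ℂ → ℂ := fun w => Complex.log (P w / P s) with hh
    have han : AnalyticAt ℂ h s := by
      refine AnalyticAt.clog ?_ (by simp [hPs0])
      have : AnalyticAt ℂ P s := by simp only [hP]; fun_prop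
      exact this.div_const
    have hderiv : HasDerivAt h ((N * (s - a) ^ (N - 1) / P s) / (P s / P s)) s :=
      (hPd.div_const (P s)).clog (by simp [hPs0])
    refine differentiableAt_of_re_ne_zero (h := h) (hΩ.mem_nhds hs.1) han ?_ hc fun w hw hre => ?_
    · rw [hderiv.deriv]
      have : (N : ℂ) ≠ 0 := by exact_mod_cast hN.ne'
      positivity
    · refine hd.differentiableAt
        ((hΩ.sdiff (isClosed_lemniscate N a b ρ)).mem_nhds ⟨hw, fun hwK => hre ?_⟩)
      have : ‖P w‖ = ρ := hwK
      simp only [hh, Complex.log_re, norm_div, this, hPs]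
      rw [div_self hρ.ne', Real.log_one]

/-! ### Area integrals in polar coordinates -/

lemma integrableOn_polarCoord_target {f : ℂ → ℂ} (hf : MeasureTheory.Integrable f) :
    MeasureTheory.IntegrableOn (fun p : ℝ × ℝ => p.1 • f (Complex.polarCoord.symm p))
      polarCoord.target := by
  have h1 : MeasureTheory.Integrable (f ∘ Complex.measurableEquivRealProd.symm) :=
    (Complex.volume_preserving_equiv_real_prod.symm).integrable_comp_of_integrable hf
  have h2 := (MeasureTheory.integrableOn_image_iff_integrableOn_abs_det_fderiv_smul
    MeasureTheory.volume polarCoord.open_target.measurableSet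
    (fun p _ => (hasFDerivAt_polarCoord_symm p).hasFDerivWithinAt) polarCoord.symm.injOn
    (f ∘ Complex.measurableEquivRealProd.symm)).1 h1.integrableOn
  refine h2.congr_fun (fun p hp => ?_) polarCoord.open_target.measurableSet
  have hp' : 0 < p.1 := hp.1
  simp only [det_fderivPolarCoordSymm, abs_of_pos hp', Function.comp]
  rfl

lemma integral_eq_integral_circleMap {f : ℂ → ℂ} (hf : MeasureTheory.Integrable f) :
    ∫ z, f z = ∫ r in Set.Ioi (0 : ℝ), r • ∫ θ in -Real.pi..Real.pi, f (circleMap 0 r θ) := by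
  have h := integrableOn_polarCoord_target hf
  rw [← Complex.integral_comp_polarCoord_symm]
  rw [polarCoord_target] at h ⊢
  rw [MeasureTheory.Measure.volume_eq_prod, MeasureTheory.setIntegral_prod _ h]
  refine MeasureTheory.setIntegral_congr_fun measurableSet_Ioi fun r hr => ?_
  simp only
  rw [MeasureTheory.integral_smul, intervalIntegral.integral_of_le (by linarith [Real.pi_pos]),
    MeasureTheory.integral_Ioc_eq_integral_Ioo]
  congr 1
  refine MeasureTheory.setIntegral_congr_fun measurableSet_Ioo fun θ _ => ?_
  simp [circleMap, Complex.exp_mul_I]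

/-- The power map `u ↦ u ^ N` covers the plane `N` times, with Jacobian `|N u ^ (N - 1)| ^ 2`. -/
lemma integral_comp_pow {N : ℕ} (hN : 0 < N) {φ : ℂ → ℂ} (hφ : MeasureTheory.Integrable φ)
    (hφN : MeasureTheory.Integrable fun u : ℂ => ((N : ℝ) * ‖u‖ ^ (N - 1)) ^ 2 • φ (u ^ N)) :
    ∫ u : ℂ, ((N : ℝ) * ‖u‖ ^ (N - 1)) ^ 2 • φ (u ^ N) = (N : ℝ) • ∫ z, φ z := by
  have hN' : (0 : ℝ) < N := by exact_mod_cast hN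
  rw [integral_eq_integral_circleMap hφ, integral_eq_integral_circleMap hφN,
    ← MeasureTheory.integral_comp_rpow_Ioi_of_pos
      (g := fun s : ℝ => s • ∫ θ in -Real.pi..Real.pi, φ (circleMap 0 s θ)) hN',
    ← MeasureTheory.integral_smul]
  refine MeasureTheory.setIntegral_congr_fun measurableSet_Ioi fun r hr => ?_
  have hr' : (0 : ℝ) < r := hr
  have hper : Function.Periodic (fun θ => φ (circleMap 0 (r ^ N) θ)) (2 * Real.pi) := fun θ => by
    simp only [periodic_circleMap 0 (r ^ N) θ]
  have hang : ∫ θ in -Real.pi..Real.pi, φ (circleMap 0 r θ ^ N) =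
      ∫ θ in -Real.pi..Real.pi, φ (circleMap 0 (r ^ N) θ) := by
    have h1 : ∀ θ : ℝ, circleMap 0 r θ ^ N = circleMap 0 (r ^ N) (N * θ) := fun θ => by
      simp only [circleMap, zero_add, mul_pow, ← Complex.exp_nat_mul]
      push_cast; ring_nf
    simp only [h1]
    rw [intervalIntegral.integral_comp_mul_left (fun θ => φ (circleMap 0 (r ^ N) θ)) hN'.ne']
    by_cases hint : IntervalIntegrable (fun θ => φ (circleMap 0 (r ^ N) θ))
        MeasureTheory.volume (-Real.pi) Real.pi
    swap
    · -- both integrals take the junk value `0`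
      rw [intervalIntegral.integral_undef hint, intervalIntegral.integral_undef, smul_zero]
      refine fun h => hint (h.mono_set ?_)
      have h1N : (1 : ℝ) ≤ N := by exact_mod_cast hN
      have hπ := Real.pi_pos
      rw [Set.uIcc_of_le (by linarith), Set.uIcc_of_le (by nlinarith)]
      exact Set.Icc_subset_Icc (by nlinarith) (by nlinarith)
    have h2 := hper.intervalIntegral_add_zsmul_eq N (N * -Real.pi) fun t₁ t₂ => by
      refine hper.intervalIntegrable (t := -Real.pi) (by positivity) ?_ t₁ t₂
      rwa [show -Real.pi + 2 * Real.pi = Real.pi by ring]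
    have e1 : (N : ℝ) * -Real.pi + (N : ℤ) • (2 * Real.pi) = N * Real.pi := by
      simp; ring
    have e2 : -Real.pi + 2 * Real.pi = Real.pi := by ring
    rw [e1] at h2
    have h4 := hper.intervalIntegral_add_eq (N * -Real.pi) (-Real.pi)
    rw [e2] at h4
    rw [h2, h4]
    rw [natCast_zsmul, ← Nat.cast_smul_eq_nsmul ℝ, smul_smul, inv_mul_cancel₀ hN'.ne', one_smul]
  have hnorm : ∀ θ, ‖circleMap 0 r θ‖ = r := fun θ => by
    rw [norm_circleMap_zero, abs_of_pos hr']
  simp only [hnorm]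
  rw [intervalIntegral.integral_smul, hang, Real.rpow_natCast]
  have hNr : r ^ ((N : ℝ) - 1) = r ^ (N - 1) := by
    rw [← Real.rpow_natCast r (N - 1), Nat.cast_sub hN, Nat.cast_one]
  rw [hNr, smul_smul, smul_smul, smul_smul]
  congr 1
  have : r ^ N = r ^ (N - 1) * r := by rw [← pow_succ, Nat.sub_add_cancel hN]
  rw [this]; ring

/-- The mean value property over a disc. -/
lemma setIntegral_ball_of_differentiableOn {H : ℂ → ℂ} {c : ℂ} {R ρ : ℝ} (hR : 0 < R)
    (hRρ : R < ρ) (hH : DifferentiableOn ℂ H (Metric.ball c ρ)) :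
    ∫ z in Metric.ball c R, H z = (Real.pi : ℂ) * (R : ℂ) ^ 2 * H c := by
  have hcl : Metric.closedBall c R ⊆ Metric.ball c ρ := Metric.closedBall_subset_ball hRρ
  have hint : MeasureTheory.IntegrableOn H (Metric.ball c R) :=
    ((hH.continuousOn.mono hcl).integrableOn_compact (isCompact_closedBall c R)).mono_set
      Metric.ball_subset_closedBall
  rw [← MeasureTheory.integral_indicator measurableSet_ball,
    ← MeasureTheory.integral_add_left_eq_self _ c,
    integral_eq_integral_circleMap ((hint.integrable_indicator measurableSet_ball).comp_add_left c)]
  have key : ∀ r ∈ Set.Ioi (0 : ℝ),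
      (r • ∫ θ in -Real.pi..Real.pi, (Metric.ball c R).indicator H (c + circleMap 0 r θ)) =
      (Set.Iio R).indicator (fun r : ℝ => r • ((2 * Real.pi : ℂ) * H c)) r := by
    intro r hr
    have hr' : (0 : ℝ) < r := hr
    have hmem : ∀ θ, (c + circleMap 0 r θ ∈ Metric.ball c R ↔ r < R) := fun θ => by
      rw [mem_ball_iff_norm, add_sub_cancel_left, norm_circleMap_zero, abs_of_pos hr']
    by_cases hrR : r < R
    · rw [Set.indicator_of_mem (show r ∈ Set.Iio R from hrR)]
      congr 1
      have hm : Real.circleAverage H c r = H c := by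
        refine DiffContOnCl.circleAverage ((hH.mono ?_).diffContOnCl)
        rw [abs_of_pos hr', closure_ball _ hr'.ne']
        exact Metric.closedBall_subset_ball (hrR.trans hRρ)
      have hper : Function.Periodic (fun θ => H (circleMap c r θ)) (2 * Real.pi) := fun θ => by
        simp only [periodic_circleMap c r θ]
      have h3 := hper.intervalIntegral_add_eq 0 (-Real.pi)
      rw [show -Real.pi + 2 * Real.pi = Real.pi by ring, zero_add] at h3
      rw [Real.circleAverage_def, h3] at hm
      rw [← hm]
      have h4 : ∀ θ : ℝ, (Metric.ball c R).indicator H (c + circleMap 0 r θ) =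
          H (circleMap c r θ) := fun θ => by
        rw [Set.indicator_of_mem ((hmem θ).2 hrR)]
        simp [circleMap]
      simp only [h4]
      rw [Complex.real_smul]
      push_cast
      have : (Real.pi : ℂ) ≠ 0 := by exact_mod_cast Real.pi_ne_zero
      field_simp
    · rw [Set.indicator_of_notMem (show r ∉ Set.Iio R from hrR)]
      have h4 : ∀ θ : ℝ, (Metric.ball c R).indicator H (c + circleMap 0 r θ) = 0 := fun θ =>
        Set.indicator_of_notMem (fun h => hrR ((hmem θ).1 h)) _
      simp [h4]
  rw [MeasureTheory.setIntegral_congr_fun measurableSet_Ioi key,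
    MeasureTheory.setIntegral_indicator measurableSet_Iio, Set.Ioi_inter_Iio,
    ← MeasureTheory.integral_Ioc_eq_integral_Ioo, ← intervalIntegral.integral_of_le hR.le,
    intervalIntegral.integral_smul_const, integral_id]
  rw [Complex.real_smul]
  push_cast
  ring

/-! ### The quadrature identity -/

/-- The sum of `f` over the `N`-th roots of `ζ` is a holomorphic function of `ζ`, also at the
branch point `ζ = 0`. -/
lemma exists_trace {N : ℕ} (hN : 0 < N) {f : ℂ → ℂ} {D : Set ℂ} (hD : IsOpen D)
    (hf : DifferentiableOn ℂ f {u | u ^ N ∈ D}) :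
    ∃ K : ℂ → ℂ, DifferentiableOn ℂ K D ∧
      ∀ u, K (u ^ N) = ∑ ω ∈ Polynomial.nthRootsFinset N (1 : ℂ), f (ω * u) := by
  set F : ℂ → ℂ := fun u => ∑ ω ∈ Polynomial.nthRootsFinset N (1 : ℂ), f (ω * u) with hF
  have hmem : ∀ {ω : ℂ}, ω ∈ Polynomial.nthRootsFinset N (1 : ℂ) ↔ ω ^ N = 1 :=
    fun {ω} => Polynomial.mem_nthRootsFinset hN 1
  have hinv : ∀ v w : ℂ, w ^ N = v ^ N → F w = F v := by
    intro v w h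
    by_cases hv : v = 0
    · subst hv
      rw [zero_pow hN.ne'] at h
      rw [pow_eq_zero_iff hN.ne'] at h
      rw [h]
    · have hτ : (w / v) ^ N = 1 := by
        rw [div_pow, h, div_self (pow_ne_zero _ hv)]
      have hτ0 : w / v ≠ 0 := by
        intro h0; rw [h0, zero_pow hN.ne'] at hτ; exact zero_ne_one hτ
      refine Finset.sum_bij (fun ω _ => ω * (w / v)) ?_ ?_ ?_ ?_
      · intro ω hω
        rw [hmem] at hω ⊢
        rw [mul_pow, hω, hτ, one_mul]
      · intro ω₁ _ ω₂ _ h12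
        exact mul_right_cancel₀ hτ0 h12
      · intro ω hω
        refine ⟨ω / (w / v), ?_, div_mul_cancel₀ _ hτ0⟩
        rw [hmem] at hω ⊢
        rw [div_pow, hω, hτ, div_one]
      · intro ω _
        congr 1
        field_simp
  have hO : IsOpen {u : ℂ | u ^ N ∈ D} := hD.preimage (continuous_pow N)
  have hFd : ∀ u : ℂ, u ^ N ∈ D → DifferentiableAt ℂ F u := by
    intro u hu
    refine DifferentiableAt.fun_sum fun ω hω => ?_
    have : DifferentiableAt ℂ f (ω * u) := by
      refine hf.differentiableAt (hO.mem_nhds ?_)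
      rw [hmem] at hω
      simpa [mul_pow, hω] using hu
    exact this.comp u (by fun_prop)
  have hroot : ∀ ζ : ℂ, (ζ ^ ((N : ℂ)⁻¹)) ^ N = ζ := fun ζ => Complex.cpow_nat_inv_pow ζ hN.ne'
  set K : ℂ → ℂ := fun ζ => F (ζ ^ ((N : ℂ)⁻¹)) with hK
  refine ⟨K, ?_, fun u => hinv _ _ (hroot _)⟩
  have hoff : DifferentiableOn ℂ K (D \ {0}) := by
    rintro ζ₀ ⟨hζD, hζ0⟩
    obtain ⟨b, hbN⟩ : ∃ b : ℂ, b ^ N = ζ₀ := ⟨_, hroot ζ₀⟩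
    have hbN0 : b ^ N ≠ 0 := by rw [hbN]; exact hζ0
    -- the branch of the root that is holomorphic at `ζ₀`
    have hKe : K = fun ζ => F (b * (ζ / b ^ N) ^ ((N : ℂ)⁻¹)) := by
      funext ζ
      refine hinv _ _ ?_
      rw [hroot ζ, mul_pow, hroot (ζ / b ^ N), mul_div_cancel₀ _ hbN0]
    rw [hKe]
    refine DifferentiableAt.differentiableWithinAt ?_
    refine DifferentiableAt.comp (g := F) ζ₀ (hFd _ ?_) ?_
    · rw [mul_pow, hroot (ζ₀ / b ^ N), mul_div_cancel₀ _ hbN0]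
      exact hζD
    · refine DifferentiableAt.const_mul ?_ b
      refine DifferentiableAt.cpow (by fun_prop) (by fun_prop) ?_
      rw [hbN, div_self hζ0]
      exact Complex.one_mem_slitPlane
  refine (ContRemovable.singleton 0).differentiableOn D K hD (fun ζ hζ => ?_) hoff
  refine ContinuousAt.continuousWithinAt ?_
  by_cases hζ0 : ζ = 0
  · subst hζ0
    refine ContinuousAt.comp (g := F) (hFd _ ?_).continuousAt ?_
    · rwa [hroot 0]
    · refine Complex.continuousAt_cpow_const_of_re_pos (Or.inl le_rfl) ?_
      rw [← Complex.ofReal_natCast, ← Complex.ofReal_inv, Complex.ofReal_re]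
      positivity
  · exact (hoff.differentiableAt
      ((hD.sdiff isClosed_singleton).mem_nhds ⟨hζ, hζ0⟩)).continuousAt

lemma isCompact_pow_sub_le {N : ℕ} (hN : 0 < N) (b : ℂ) (R : ℝ) :
    IsCompact {u : ℂ | ‖u ^ N - b‖ ≤ R} := by
  refine Metric.isCompact_of_isClosed_isBounded (isClosed_le (by fun_prop) continuous_const) ?_
  refine (Metric.isBounded_closedBall (x := (0 : ℂ)) (r := max 1 (R + ‖b‖))).subset fun u hu => ?_
  have hu' : ‖u ^ N - b‖ ≤ R := hu
  rw [mem_closedBall_zero_iff]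
  by_contra! hlt
  have h1 : 1 < ‖u‖ := (le_max_left _ _).trans_lt hlt
  have h2 : R + ‖b‖ < ‖u‖ := (le_max_right _ _).trans_lt hlt
  have h3 : ‖u‖ ≤ ‖u‖ ^ N := le_self_pow₀ h1.le hN.ne'
  have h4 : ‖u‖ ^ N ≤ ‖u ^ N - b‖ + ‖b‖ := by
    rw [← norm_pow]
    simpa using norm_add_le (u ^ N - b) b
  linarith

/-- Replacing `u` by `ω u` with `ω ^ N = 1` does not change an integral over `{‖u^N - b‖ < R}`. -/
lemma setIntegral_comp_mul_root {N : ℕ} (hN : 0 < N) (b : ℂ) (R : ℝ) {ω : ℂ} (hω : ω ^ N = 1)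
    (Φ : ℂ → ℂ) :
    ∫ u in {u : ℂ | ‖u ^ N - b‖ < R}, Φ (ω * u) = ∫ u in {u : ℂ | ‖u ^ N - b‖ < R}, Φ u := by
  have hω1 : ‖ω‖ = 1 := Complex.norm_eq_one_of_pow_eq_one hω hN.ne'
  let e : ℂ ≃ₗᵢ[ℝ] ℂ := rotation ⟨ω, mem_sphere_zero_iff_norm.2 hω1⟩
  have he : ∀ u, e u = ω * u := fun u => rotation_apply _ _
  have h := e.measurePreserving.setIntegral_preimage_emb
    e.toHomeomorph.measurableEmbedding Φ {u : ℂ | ‖u ^ N - b‖ < R}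
  simp only [he] at h
  rw [← h]
  congr 2
  ext u
  simp [he, mul_pow, hω]

/-- The quadrature identity for the domain `{‖u^N - b‖ < R}` and an integrand that is
holomorphic in a neighbourhood of its closure. Averaging over rotations by `N`-th roots of unity
turns the integrand into `|u^(N-1)|² H(u^N)` with `H` holomorphic, and the substitution
`ζ = u^N` reduces the claim to the mean value property of `H`. -/
lemma setIntegral_conj_pow_mul {N : ℕ} (hN : 0 < N) {b : ℂ} (hb : b ≠ 0) {R ρ : ℝ} (hR : 0 < R)
    (hRρ : R < ρ) {g : ℂ → ℂ} (hg : DifferentiableOn ℂ g {u | ‖u ^ N - b‖ < ρ}) {u₀ : ℂ}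
    (hu₀ : u₀ ^ N = b) :
    ∫ u in {u : ℂ | ‖u ^ N - b‖ < R}, (N : ℂ) * conj u ^ (N - 1) * g u =
      (Real.pi : ℂ) * (R : ℂ) ^ 2 *
        ∑ ω ∈ Polynomial.nthRootsFinset N (1 : ℂ), ω * u₀ * g (ω * u₀) / (N * b) := by
  have hN0 : (N : ℂ) ≠ 0 := by exact_mod_cast hN.ne'
  have hmem : ∀ {ω : ℂ}, ω ∈ Polynomial.nthRootsFinset N (1 : ℂ) ↔ ω ^ N = 1 :=
    fun {ω} => Polynomial.mem_nthRootsFinset hN 1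
  have hset : {u : ℂ | u ^ N ∈ Metric.ball b ρ} = {u | ‖u ^ N - b‖ < ρ} := by
    ext u; exact mem_ball_iff_norm
  obtain ⟨K, hKd, hK⟩ := exists_trace hN (f := fun u => u * g u)
    (Metric.isOpen_ball (x := b) (ε := ρ)) (by rw [hset]; exact differentiableOn_id.mul hg)
  have hK0 : K 0 = 0 := by
    have := hK 0
    simpa [zero_pow hN.ne'] using this
  set H : ℂ → ℂ := dslope K 0 with hHdef
  have hHne : ∀ ζ, ζ ≠ 0 → H ζ = K ζ / ζ := fun ζ hζ => by
    rw [hHdef, dslope_of_ne _ hζ, slope_def_field, hK0, sub_zero, sub_zero]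
  have hHd : DifferentiableOn ℂ H (Metric.ball b ρ) := by
    by_cases h0 : (0 : ℂ) ∈ Metric.ball b ρ
    · exact (Complex.differentiableOn_dslope (Metric.isOpen_ball.mem_nhds h0)).2 hKd
    · intro ζ hζ
      have hζ0 : ζ ≠ 0 := fun h => h0 (h ▸ hζ)
      exact ((differentiableAt_dslope_of_ne hζ0).2
        (hKd.differentiableAt (Metric.isOpen_ball.mem_nhds hζ))).differentiableWithinAt
  set E : Set ℂ := {u : ℂ | ‖u ^ N - b‖ < R} with hE
  have hEo : IsOpen E := isOpen_lt (by fun_prop) continuous_const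
  have hEc : IsCompact {u : ℂ | ‖u ^ N - b‖ ≤ R} := isCompact_pow_sub_le hN b R
  have hEsub : E ⊆ {u : ℂ | ‖u ^ N - b‖ ≤ R} := fun u hu =>
    le_of_lt (show ‖u ^ N - b‖ < R from hu)
  have hcsub : {u : ℂ | ‖u ^ N - b‖ ≤ R} ⊆ {u : ℂ | ‖u ^ N - b‖ < ρ} :=
    fun u hu => lt_of_le_of_lt (show ‖u ^ N - b‖ ≤ R from hu) hRρ
  set Φ : ℂ → ℂ := fun u => (N : ℂ) * conj u ^ (N - 1) * g u with hΦ
  have hΦi : ∀ ω : ℂ, ω ^ N = 1 → MeasureTheory.IntegrableOn (fun u => Φ (ω * u)) E := by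
    intro ω hω
    refine (ContinuousOn.integrableOn_compact hEc ?_).mono_set hEsub
    have h1 : ContinuousOn (fun u => g (ω * u)) {u : ℂ | ‖u ^ N - b‖ ≤ R} := by
      refine hg.continuousOn.comp (by fun_prop) fun u hu => hcsub ?_
      simpa [mul_pow, hω] using hu
    have h2 : Continuous fun u : ℂ => (N : ℂ) * conj (ω * u) ^ (N - 1) :=
      continuous_const.mul ((Complex.continuous_conj.comp (continuous_const_mul ω)).pow _)
    exact h2.continuousOn.mul h1
  have hcard : (Polynomial.nthRootsFinset N (1 : ℂ)).card = N :=
    (Complex.isPrimitiveRoot_exp N hN.ne').card_nthRootsFinset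
  have havg : (N : ℂ) * ∫ u in E, Φ u =
      ∫ u in E, ∑ ω ∈ Polynomial.nthRootsFinset N (1 : ℂ), Φ (ω * u) := by
    rw [MeasureTheory.integral_finsetSum _ fun ω hω => hΦi ω (hmem.1 hω)]
    rw [Finset.sum_congr rfl fun ω hω => setIntegral_comp_mul_root hN b R (hmem.1 hω) Φ,
      Finset.sum_const, hcard, nsmul_eq_mul]
  have hsym : ∀ u : ℂ, u ≠ 0 → ∑ ω ∈ Polynomial.nthRootsFinset N (1 : ℂ), Φ (ω * u) =
      (N : ℂ) * ((‖u‖ : ℂ) ^ (N - 1)) ^ 2 * H (u ^ N) := by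
    intro u hu
    rw [hHne _ (pow_ne_zero _ hu), hK, Finset.sum_div, Finset.mul_sum]
    refine Finset.sum_congr rfl fun ω hω => ?_
    have hω' := hmem.1 hω
    have hv : (ω * u) ^ N = u ^ N := by rw [mul_pow, hω', one_mul]
    have hvn : ‖ω * u‖ = ‖u‖ := by
      rw [norm_mul, Complex.norm_eq_one_of_pow_eq_one hω' hN.ne', one_mul]
    have hv0 : u ^ N ≠ 0 := pow_ne_zero _ hu
    have h1 : (ω * u) ^ N = (ω * u) ^ (N - 1) * (ω * u) := by
      rw [← pow_succ, Nat.sub_add_cancel hN]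
    have h2 : ((‖u‖ : ℂ) ^ (N - 1)) ^ 2 = conj (ω * u) ^ (N - 1) * (ω * u) ^ (N - 1) := by
      rw [← mul_pow, Complex.conj_mul', hvn]; ring
    rw [h2]
    simp only [hΦ]
    rw [← hv] at hv0 ⊢
    field_simp
    rw [h1]
    ring
  have hint : ∫ u in E, ∑ ω ∈ Polynomial.nthRootsFinset N (1 : ℂ), Φ (ω * u) =
      ∫ u in E, (N : ℂ) * ((‖u‖ : ℂ) ^ (N - 1)) ^ 2 * H (u ^ N) := by
    refine MeasureTheory.setIntegral_congr_ae hEo.measurableSet ?_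
    have : ∀ᵐ u : ℂ, u ≠ 0 := by
      simp [MeasureTheory.ae_iff]
    filter_upwards [this] with u hu _ using hsym u hu
  set φ : ℂ → ℂ := (Metric.ball b R).indicator H with hφ
  have hφi : MeasureTheory.Integrable φ := by
    refine MeasureTheory.IntegrableOn.integrable_indicator ?_ measurableSet_ball
    exact ((hHd.continuousOn.mono (Metric.closedBall_subset_ball hRρ)).integrableOn_compact
      (isCompact_closedBall b R)).mono_set Metric.ball_subset_closedBall
  have hφN : (fun u : ℂ => ((N : ℝ) * ‖u‖ ^ (N - 1)) ^ 2 • φ (u ^ N)) =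
      E.indicator fun u => ((N : ℂ) * (‖u‖ : ℂ) ^ (N - 1)) ^ 2 * H (u ^ N) := by
    funext u
    by_cases hu : u ∈ E
    · have hu' : u ^ N ∈ Metric.ball b R := mem_ball_iff_norm.2 hu
      rw [Set.indicator_of_mem hu, hφ, Set.indicator_of_mem hu', Complex.real_smul]
      push_cast; ring
    · have hu' : u ^ N ∉ Metric.ball b R := fun h => hu (mem_ball_iff_norm.1 h)
      rw [Set.indicator_of_notMem hu, hφ, Set.indicator_of_notMem hu', smul_zero]
  have hφNi : MeasureTheory.Integrable
      (fun u : ℂ => ((N : ℝ) * ‖u‖ ^ (N - 1)) ^ 2 • φ (u ^ N)) := by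
    rw [hφN]
    refine MeasureTheory.IntegrableOn.integrable_indicator ?_ hEo.measurableSet
    refine (ContinuousOn.integrableOn_compact hEc ?_).mono_set hEsub
    have h1 : ContinuousOn (fun u : ℂ => H (u ^ N)) {u : ℂ | ‖u ^ N - b‖ ≤ R} :=
      hHd.continuousOn.comp (by fun_prop) fun u hu =>
        mem_ball_iff_norm.2 (hcsub hu)
    have h2 : Continuous fun u : ℂ => ((N : ℂ) * (‖u‖ : ℂ) ^ (N - 1)) ^ 2 :=
      (continuous_const.mul ((Complex.continuous_ofReal.comp continuous_norm).pow _)).pow 2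
    exact h2.continuousOn.mul h1
  have hcv := integral_comp_pow hN hφi hφNi
  rw [hφN, MeasureTheory.integral_indicator hEo.measurableSet,
    MeasureTheory.integral_indicator measurableSet_ball,
    setIntegral_ball_of_differentiableOn hR hRρ hHd, hHne b hb] at hcv
  have hKb := hK u₀
  rw [hu₀] at hKb
  rw [hint] at havg
  have h3 : ∫ u in E, ((N : ℂ) * (‖u‖ : ℂ) ^ (N - 1)) ^ 2 * H (u ^ N) =
      N * ∫ u in E, (N : ℂ) * ((‖u‖ : ℂ) ^ (N - 1)) ^ 2 * H (u ^ N) := by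
    rw [← MeasureTheory.integral_const_mul]
    congr 1
    funext u
    ring
  rw [h3, ← havg, hKb, Complex.real_smul] at hcv
  rw [← Finset.sum_div]
  push_cast at hcv
  have h4 := mul_left_cancel₀ hN0 hcv
  rw [mul_div_assoc', eq_div_iff (mul_ne_zero hN0 hb)]
  rw [mul_div_assoc', eq_div_iff hb] at h4
  linear_combination h4

/-- If `z` enumerates the roots of `(z - d₀)^N = d₁`, then `∏_{s ≠ k} (z_k - z_s)` is the derivative
`N (z_k - d₀)^(N-1)`. -/
lemma prod_erase_sub {N : ℕ} {d₀ d₁ : ℂ} {z : Fin N → ℂ} (hz : Function.Injective z)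
    (hroot : ∀ k, (z k - d₀) ^ N = d₁) (k : Fin N) :
    ∏ s ∈ Finset.univ.erase k, (z k - z s) = N * (z k - d₀) ^ (N - 1) := by
  have hN : 0 < N := k.pos
  have hp : ((Polynomial.X - Polynomial.C d₀ : Polynomial ℂ) ^ N - Polynomial.C d₁) =
      Lagrange.nodal Finset.univ z := by
    have hmon : ((Polynomial.X - Polynomial.C d₀ : Polynomial ℂ) ^ N).Monic :=
      (Polynomial.monic_X_sub_C d₀).pow N
    have hdeg : ((Polynomial.X - Polynomial.C d₀ : Polynomial ℂ) ^ N).degree = N := by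
      rw [Polynomial.degree_pow, Polynomial.degree_X_sub_C]; simp
    have hC : (Polynomial.C d₁ : Polynomial ℂ).degree <
        ((Polynomial.X - Polynomial.C d₀ : Polynomial ℂ) ^ N).degree := by
      rw [hdeg]
      exact Polynomial.degree_C_le.trans_lt (by exact_mod_cast hN)
    have hmon' := hmon.sub_of_left hC
    have hdeg' := (Polynomial.degree_sub_eq_left_of_degree_lt hC).trans hdeg
    refine Polynomial.eq_of_degree_sub_lt_of_eval_index_eq (v := z) Finset.univ hz.injOn ?_ ?_
    · have hnd : (Lagrange.nodal Finset.univ z).degree = N := by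
        rw [Lagrange.degree_nodal, Finset.card_univ, Fintype.card_fin]
      refine (Polynomial.degree_sub_lt_left (hdeg'.trans hnd.symm) hmon'.ne_zero ?_).trans_le ?_
      · rw [hmon'.leadingCoeff, Lagrange.nodal_monic.leadingCoeff]
      · rw [hdeg', Finset.card_univ, Fintype.card_fin]
    · intro i _
      rw [Lagrange.eval_nodal_at_node (Finset.mem_univ i)]
      simp [hroot i]
  rw [← Lagrange.eval_nodal,
    ← Lagrange.eval_nodal_derivative_eval_node_eq (Finset.mem_univ k), ← hp]
  simp [Polynomial.derivative_pow]

/-- The roots of `(z - d₀)^N = d₁` are `d₀ + ω u₀`, where `ω` runs over the `N`-th roots of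
unity. -/
lemma sum_nthRootsFinset_eq {N : ℕ} {d₀ d₁ : ℂ} (hd₁ : d₁ ≠ 0) {z : Fin N → ℂ}
    (hz : Function.Injective z) (hroot : ∀ k, (z k - d₀) ^ N = d₁) (k₀ : Fin N) (q : ℂ → ℂ) :
    ∑ ω ∈ Polynomial.nthRootsFinset N (1 : ℂ), q (ω * (z k₀ - d₀)) = ∑ k, q (z k - d₀) := by
  have hN : 0 < N := k₀.pos
  have hu0 : z k₀ - d₀ ≠ 0 := by
    intro h
    have := hroot k₀
    rw [h, zero_pow hN.ne'] at this
    exact hd₁ this.symm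
  have hinj : Function.Injective fun k => (z k - d₀) / (z k₀ - d₀) := fun i j h =>
    hz (sub_left_injective ((div_left_inj' hu0).1 h))
  have himg : Finset.univ.image (fun k => (z k - d₀) / (z k₀ - d₀)) =
      Polynomial.nthRootsFinset N (1 : ℂ) := by
    refine Finset.eq_of_subset_of_card_le ?_ ?_
    · intro w hw
      obtain ⟨k, -, rfl⟩ := Finset.mem_image.1 hw
      rw [Polynomial.mem_nthRootsFinset hN, div_pow, hroot, hroot, div_self hd₁]
    · rw [Finset.card_image_of_injective _ hinj, Finset.card_univ, Fintype.card_fin,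
        (Complex.isPrimitiveRoot_exp N hN.ne').card_nthRootsFinset]
  rw [← himg, Finset.sum_image hinj.injOn]
  exact Finset.sum_congr rfl fun k _ => by rw [div_mul_cancel₀ _ hu0]

/-! ### Cauchy transforms over quadrature domains -/

/-- The singularity `1 / (w - s)` is integrable, so Cauchy transforms make sense up to the boundary
of the domain. -/
lemma integrableOn_inv_sub {K : Set ℂ} (hK : Bornology.IsBounded K) (s : ℂ) :
    MeasureTheory.IntegrableOn (fun w => (w - s)⁻¹) K := by
  have hloc : MeasureTheory.LocallyIntegrable (fun w : ℂ => w⁻¹) := by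
    refine MeasureTheory.locallyIntegrable_of_norm_le_rpow (C := 1) (α := 1) ?_ ?_ ?_ ?_
    · rw [Complex.finrank_real_complex]; norm_num
    · rw [Complex.finrank_real_complex]; norm_num
    · exact Eventually.of_forall fun w => by rw [norm_inv, one_mul, Real.rpow_neg_one]
    · exact measurable_inv.aestronglyMeasurable
  obtain ⟨R, hR⟩ := hK.subset_closedBall s
  have h1 := (MeasureTheory.measurePreserving_sub_right
    (MeasureTheory.volume : MeasureTheory.Measure ℂ) s).integrableOn_comp_preimage
    (measurableEmbedding_subRight s) (f := fun w : ℂ => w⁻¹)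
    (s := Metric.closedBall 0 R)
  refine (h1.2 (hloc.integrableOn_isCompact (isCompact_closedBall 0 R))).mono_set ?_
  intro w hw
  simpa [dist_eq_norm] using hR hw

lemma isOpen_quadratureDomain (m : ℕ) (d₀ d₁ : ℂ) (ρ : ℝ) : IsOpen (quadratureDomain m d₀ d₁ ρ) :=
  isOpen_const.and (isOpen_lt (by fun_prop) continuous_const)

lemma quadratureDomain_zero (d₀ d₁ : ℂ) (ρ : ℝ) : quadratureDomain 0 d₀ d₁ ρ = ∅ := by
  ext w; simp [quadratureDomain]

lemma isBounded_quadratureDomain (m : ℕ) (d₀ d₁ : ℂ) (ρ : ℝ) :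
    Bornology.IsBounded (quadratureDomain m d₀ d₁ ρ) := by
  rcases Nat.eq_zero_or_pos m with rfl | hm
  · rw [quadratureDomain_zero]; exact Bornology.isBounded_empty
  · obtain ⟨R, hR⟩ := (isCompact_pow_sub_le hm d₁ ρ).isBounded.subset_closedBall 0
    refine (Metric.isBounded_closedBall (x := d₀) (r := R)).subset fun w hw => ?_
    have := hR (show w - d₀ ∈ _ from le_of_lt hw.2)
    simpa [dist_eq_norm] using this

lemma integrableOn_density_div_sub {N : ℕ} {d₀ d₁ : ℂ} {ρ : ℝ} {ϖ e : ℂ → ℂ}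
    (hϖ : DiffContOnCl ℂ ϖ (quadratureDomain N d₀ d₁ ρ)) (he : Continuous e) (s : ℂ) :
    MeasureTheory.IntegrableOn (fun w => e w * density N d₀ ϖ w / (w - s))
      (quadratureDomain N d₀ d₁ ρ) := by
  have hb := isBounded_quadratureDomain N d₀ d₁ ρ
  have hc : ContinuousOn (fun w => e w * density N d₀ ϖ w)
      (closure (quadratureDomain N d₀ d₁ ρ)) := by
    refine he.continuousOn.mul (ContinuousOn.mul ?_ hϖ.continuousOn)
    exact (continuous_const.mul
      ((Complex.continuous_conj.sub continuous_const).pow _)).continuousOn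
  obtain ⟨C, hC⟩ := hb.isCompact_closure.exists_bound_of_continuousOn hc
  have hm := (isOpen_quadratureDomain N d₀ d₁ ρ).measurableSet
  refine (integrableOn_inv_sub hb s).bdd_mul (c := C)
    ((hc.mono subset_closure).aestronglyMeasurable hm) ?_
  filter_upwards [MeasureTheory.ae_restrict_mem hm] with w hw using hC w (subset_closure hw)

/-- Off its quadrature domain, the Cauchy transform of the shielded density is that of finitely many
point masses. -/
lemma upperTransform_density (x t : ℝ) {N : ℕ} {d₀ d₁ : ℂ} {ρ : ℝ} (hd₁ : d₁ ≠ 0) (hρ : 0 < ρ)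
    {ϖ : ℂ → ℂ} (hϖ : DiffContOnCl ℂ ϖ (quadratureDomain N d₀ d₁ ρ)) {z : Fin N → ℂ}
    (hz : Function.Injective z) (hroot : ∀ k, (z k - d₀) ^ N = d₁) {s : ℂ}
    (hs : s ∉ quadratureDomain N d₀ d₁ ρ) :
    upperTransform x t (quadratureDomain N d₀ d₁ ρ) (density N d₀ ϖ) s =
      ∑ k, shieldedConstant ρ ϖ z k * Complex.exp (2 * Complex.I * phase x t (z k)) /
        (z k - s) := by
  rcases Nat.eq_zero_or_pos N with rfl | hN
  · simp [upperTransform, quadratureDomain_zero]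
  set e : ℂ → ℂ := fun w => Complex.exp (2 * Complex.I * phase x t w) with he
  have hed : Differentiable ℂ e := by simp only [he, phase]; fun_prop
  set k₀ : Fin N := ⟨0, hN⟩
  set g : ℂ → ℂ := fun u => e (u + d₀) * ϖ (u + d₀) / (u + d₀ - s) with hg
  have hgd : DifferentiableOn ℂ g {u | ‖u ^ N - d₁‖ < ρ} := by
    have hmem : ∀ u ∈ {u : ℂ | ‖u ^ N - d₁‖ < ρ}, u + d₀ ∈ quadratureDomain N d₀ d₁ ρ :=
      fun u hu => ⟨hN, by simpa using hu⟩
    have hϖ' : DifferentiableOn ℂ (fun u => ϖ (u + d₀)) {u | ‖u ^ N - d₁‖ < ρ} :=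
      hϖ.differentiableOn.comp (by fun_prop) hmem
    refine ((hed.comp (differentiable_id.add_const d₀)).differentiableOn.mul hϖ').div
      (by fun_prop) fun u hu h => hs ?_
    have := hmem u hu
    rwa [sub_eq_zero.1 h] at this
  set S : ℂ := ∑ ω ∈ Polynomial.nthRootsFinset N (1 : ℂ),
    ω * (z k₀ - d₀) * g (ω * (z k₀ - d₀)) / (N * d₁) with hS
  set F : ℂ → ℂ := fun w => e w * density N d₀ ϖ w / (w - s) with hF
  -- exhaustion of the domain from inside
  set r : ℕ → ℝ := fun n => ρ - ρ / (n + 2) with hr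
  have hr0 : ∀ n, 0 < r n := fun n => by
    have : ρ / (n + 2) < ρ := div_lt_self hρ (by linarith [(n.cast_nonneg : (0 : ℝ) ≤ n)])
    simp only [hr]; linarith
  have hrρ : ∀ n, r n < ρ := fun n => by
    have : 0 < ρ / ((n : ℝ) + 2) := by positivity
    simp only [hr]; linarith
  have hrm : Monotone r := fun m n hmn => by
    have hmn' : (m : ℝ) ≤ n := by exact_mod_cast hmn
    have : ρ / ((n : ℝ) + 2) ≤ ρ / (m + 2) := by gcongr
    simp only [hr]; linarith
  have hrlim : Tendsto r atTop (𝓝 ρ) := by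
    have : Tendsto (fun n : ℕ => ρ / ((n : ℝ) + 2)) atTop (𝓝 0) :=
      tendsto_const_nhds.div_atTop (tendsto_natCast_atTop_atTop.atTop_add tendsto_const_nhds)
    simpa [hr] using tendsto_const_nhds.sub this
  have hrmeas : ∀ n, MeasurableSet {w : ℂ | ‖(w - d₀) ^ N - d₁‖ < r n} := fun n =>
    (isOpen_lt (by fun_prop) continuous_const).measurableSet
  have hInt : ∀ n, ∫ w in {w : ℂ | ‖(w - d₀) ^ N - d₁‖ < r n}, F w =
      (Real.pi : ℂ) * (r n : ℂ) ^ 2 * S := by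
    intro n
    rw [hS, ← setIntegral_conj_pow_mul hN hd₁ (hr0 n) (hrρ n) hgd (hroot k₀)]
    rw [← (MeasureTheory.measurePreserving_sub_right
      (MeasureTheory.volume : MeasureTheory.Measure ℂ) d₀).setIntegral_preimage_emb
      (measurableEmbedding_subRight d₀) (fun u => (N : ℂ) * conj u ^ (N - 1) * g u)]
    refine MeasureTheory.setIntegral_congr_fun (hrmeas n) fun w _ => ?_
    simp only [hF, hg, density, sub_add_cancel, map_sub]
    ring
  have hU : (⋃ n, {w : ℂ | ‖(w - d₀) ^ N - d₁‖ < r n}) = quadratureDomain N d₀ d₁ ρ := by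
    ext w
    constructor
    · intro hw
      obtain ⟨n, hn⟩ := Set.mem_iUnion.1 hw
      exact ⟨hN, lt_trans hn (hrρ n)⟩
    · intro hw
      obtain ⟨n, hn⟩ := (hrlim.eventually (lt_mem_nhds hw.2)).exists
      exact Set.mem_iUnion.2 ⟨n, hn⟩
  have hlim := MeasureTheory.tendsto_setIntegral_of_monotone
    (s := fun n => {w : ℂ | ‖(w - d₀) ^ N - d₁‖ < r n}) (f := F) (μ := MeasureTheory.volume)
    hrmeas
    (fun m n hmn w hw => lt_of_lt_of_le hw (hrm hmn))
    (by rw [hU]; exact integrableOn_density_div_sub hϖ hed.continuous s)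
  simp only [hInt] at hlim
  rw [hU] at hlim
  have hlim' : Tendsto (fun n => (Real.pi : ℂ) * (r n : ℂ) ^ 2 * S) atTop
      (𝓝 ((Real.pi : ℂ) * (ρ : ℂ) ^ 2 * S)) :=
    ((((Complex.continuous_ofReal.tendsto ρ).comp hrlim).pow 2).const_mul _).mul_const _
  have hval := tendsto_nhds_unique hlim hlim'
  have hπ : (Real.pi : ℂ) ≠ 0 := by exact_mod_cast Real.pi_ne_zero
  have hN0 : (N : ℂ) ≠ 0 := by exact_mod_cast hN.ne'
  have hSz : S = ∑ k, (z k - d₀) * g (z k - d₀) / (N * d₁) :=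
    sum_nthRootsFinset_eq hd₁ hz hroot k₀ fun v => v * g v / (N * d₁)
  calc upperTransform x t (quadratureDomain N d₀ d₁ ρ) (density N d₀ ϖ) s
      = (∫ w in quadratureDomain N d₀ d₁ ρ, F w) / Real.pi := rfl
    _ = (ρ : ℂ) ^ 2 * S := by rw [hval]; field_simp
    _ = _ := by
      rw [hSz, Finset.mul_sum]
      refine Finset.sum_congr rfl fun k _ => ?_
      have hk : z k - d₀ ≠ 0 := by
        intro h
        have := hroot k
        rw [h, zero_pow hN.ne'] at this
        exact hd₁ this.symm
      have h1 : d₁ = (z k - d₀) ^ (N - 1) * (z k - d₀) := by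
        rw [← pow_succ, Nat.sub_add_cancel hN, hroot k]
      have hsk : z k - s ≠ 0 := by
        intro h
        refine hs ?_
        rw [← sub_eq_zero.1 h]
        exact ⟨hN, by rw [hroot k]; simpa using hρ⟩
      simp only [shieldedConstant, hg, he, sub_add_cancel]
      rw [prod_erase_sub hz hroot k]
      nth_rewrite 1 [h1]
      field_simp

/-! ### The jump matrices as finite sums over poles -/

lemma phase_conj (x t : ℝ) (w : ℂ) : phase x t (conj w) = conj (phase x t w) := by
  simp only [phase, map_add, map_mul, map_pow, Complex.conj_ofReal, map_ofNat]

lemma conj_exp_phase (x t : ℝ) (w : ℂ) :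
    conj (Complex.exp (2 * Complex.I * phase x t w)) =
      Complex.exp (-(2 * Complex.I * phase x t (conj w))) := by
  rw [← Complex.exp_conj, phase_conj]
  simp only [map_mul, Complex.conj_I, map_ofNat]
  ring_nf

lemma conj_exp_phase_neg_conj (x t : ℝ) (w : ℂ) :
    conj (Complex.exp (2 * Complex.I * phase x t (-conj w))) =
      Complex.exp (2 * Complex.I * phase x t w) := by
  rw [conj_exp_phase, map_neg, Complex.conj_conj]
  congr 1
  simp only [phase]
  ring

/-- The reflection `w ↦ -w̄` carries the transform of the mirror poles to that of the breathers. -/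
lemma upperTransform_mirror (x t : ℝ) (D : Set ℂ) (α : ℂ → ℂ) (s : ℂ) :
    upperTransform x t (mirror D) (fun w => conj (α (-conj w))) s =
      -conj (upperTransform x t D α (-conj s)) := by
  let σ : ℂ ≃ₗᵢ[ℝ] ℂ := Complex.conjLIE.trans (LinearIsometryEquiv.neg ℝ)
  have hσ : ∀ w, σ w = -conj w := fun w => rfl
  have h := σ.measurePreserving.setIntegral_preimage_emb σ.toHomeomorph.measurableEmbedding
    (fun w => -conj (Complex.exp (2 * Complex.I * phase x t w) * α w / (w - -conj s))) D
  simp only [upperTransform]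
  rw [map_div₀, Complex.conj_ofReal, ← neg_div,
    ← integral_conj, ← MeasureTheory.integral_neg, ← h]
  congr 1
  refine congrArg _ (funext fun w => ?_)
  rw [hσ, map_div₀, map_mul, conj_exp_phase_neg_conj, ← div_neg]
  congr 1
  simp
  ring

lemma lowerTransform_conjSet (x t : ℝ) (D : Set ℂ) (α : ℂ → ℂ) (s : ℂ) :
    lowerTransform x t (conjSet D) (fun w => conj (α (conj w))) s =
      -conj (upperTransform x t D α (conj s)) := by
  let σ : ℂ ≃ₗᵢ[ℝ] ℂ := Complex.conjLIE
  have hσ : ∀ w, σ w = conj w := fun w => rfl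
  have h := σ.measurePreserving.setIntegral_preimage_emb σ.toHomeomorph.measurableEmbedding
    (fun w => -conj (Complex.exp (2 * Complex.I * phase x t w) * α w / (w - conj s))) D
  simp only [upperTransform, lowerTransform]
  rw [map_div₀, Complex.conj_ofReal, ← neg_div,
    ← integral_conj, ← MeasureTheory.integral_neg, ← h]
  congr 1
  refine congrArg _ (funext fun w => ?_)
  rw [hσ, map_div₀, map_mul, conj_exp_phase, Complex.conj_conj, ← div_neg]
  congr 1
  simp

lemma mirror_quadratureDomain (m : ℕ) (d₀ d₁ : ℂ) (ρ : ℝ) :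
    mirror (quadratureDomain m d₀ d₁ ρ) =
      quadratureDomain m (-conj d₀) ((-1) ^ m * conj d₁) ρ := by
  ext w
  have h : ‖(-conj w - d₀) ^ m - d₁‖ = ‖(w - -conj d₀) ^ m - (-1) ^ m * conj d₁‖ := by
    rw [← Complex.norm_conj]
    have : conj ((-conj w - d₀) ^ m - d₁) =
        (-1) ^ m * ((w - -conj d₀) ^ m - (-1) ^ m * conj d₁) := by
      simp only [map_sub, map_pow, map_neg, Complex.conj_conj]
      rw [mul_sub, ← mul_assoc, ← mul_pow, ← mul_pow]
      simp only [mul_neg, mul_one, neg_neg, one_pow, one_mul]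
      ring_nf
    rw [this, norm_mul, norm_pow, norm_neg, norm_one, one_pow, one_mul]
  simp only [mirror, quadratureDomain, Set.mem_ofPred_eq, h]

lemma conjSet_quadratureDomain (m : ℕ) (d₀ d₁ : ℂ) (ρ : ℝ) :
    conjSet (quadratureDomain m d₀ d₁ ρ) = quadratureDomain m (conj d₀) (conj d₁) ρ := by
  ext w
  have h : ‖(conj w - d₀) ^ m - d₁‖ = ‖(w - conj d₀) ^ m - conj d₁‖ := by
    rw [← Complex.norm_conj]
    simp
  simp only [conjSet, quadratureDomain, Set.mem_ofPred_eq, h]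

/-- `∑_p γ_p / (p - z)`, the Cauchy transform of point masses `γ_p` at the poles `p ∈ S`. -/
def poleSum (S : Finset ℂ) (γ : ℂ → ℂ) (z : ℂ) : ℂ := ∑ p ∈ S, γ p / (p - z)

lemma finite_upperPoles {N₁ N₂ : ℕ} (z : Fin N₁ → ℂ) (κ : Fin N₂ → ℂ) :
    (upperPoles z κ).Finite :=
  ((Set.finite_range z).union (Set.finite_range _)).union (Set.finite_range κ)

lemma sum_normingConstant_mul {N₁ N₂ : ℕ} (z c : Fin N₁ → ℂ) (κ h : Fin N₂ → ℂ) (q : ℂ → ℂ) :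
    ∑ p ∈ (finite_upperPoles z κ).toFinset, normingConstant z c κ h p * q p =
      ∑ k, c k * q (z k) - ∑ k, conj (c k) * q (-conj (z k)) + ∑ j, h j * q (κ j) := by
  classical
  have hm : ∀ p, p ∈ (finite_upperPoles z κ).toFinset ↔ p ∈ upperPoles z κ := fun p =>
    Set.Finite.mem_toFinset _
  have key : ∀ {n : ℕ} (v a : Fin n → ℂ), (∀ i, v i ∈ upperPoles z κ) →
      ∑ p ∈ (finite_upperPoles z κ).toFinset, (∑ i, if v i = p then a i else 0) * q p =
        ∑ i, a i * q (v i) := by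
    intro n v a hv
    simp only [Finset.sum_mul]
    rw [Finset.sum_comm]
    refine Finset.sum_congr rfl fun i _ => ?_
    simp only [ite_mul, zero_mul]
    rw [Finset.sum_ite_eq, if_pos ((hm _).2 (hv i))]
  have h1 := key z c fun i => Or.inl (Or.inl ⟨i, rfl⟩)
  have h2 := key (fun k => -conj (z k)) (fun k => conj (c k)) fun i => Or.inl (Or.inr ⟨i, rfl⟩)
  have h3 := key κ h fun i => Or.inr ⟨i, rfl⟩
  rw [← h1, ← h2, ← h3, ← Finset.sum_sub_distrib, ← Finset.sum_add_distrib]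
  refine Finset.sum_congr rfl fun p _ => ?_
  simp only [normingConstant]
  ring

/-- The norming constants with the exponentials of the phase. -/
def phasedConstant (x t : ℝ) {N₁ N₂ : ℕ} (z c : Fin N₁ → ℂ) (κ h : Fin N₂ → ℂ) (p : ℂ) : ℂ :=
  normingConstant z c κ h p * Complex.exp (2 * Complex.I * phase x t p)

section Jumps

variable {N₁ N₂ : ℕ} {d₀ d₁ : ℂ} {ρ : ℝ} {ϖ₁ ϖ₂ : ℂ → ℂ} {z : Fin N₁ → ℂ} {κ : Fin N₂ → ℂ}

/-- Off the spectrum, the entry of the jump matrix on `γ` is a finite sum over the soliton poles. -/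
lemma upperJump_entry (x t : ℝ) (hd₁ : d₁ ≠ 0) (hρ : 0 < ρ)
    (hϖ₁ : DiffContOnCl ℂ ϖ₁ (quadratureDomain N₁ d₀ d₁ ρ))
    (hϖ₂ : DiffContOnCl ℂ ϖ₂ (quadratureDomain N₂ d₀ d₁ ρ))
    (hz : Function.Injective z) (hzr : ∀ k, (z k - d₀) ^ N₁ = d₁)
    (hκ : Function.Injective κ) (hκr : ∀ j, (κ j - d₀) ^ N₂ = d₁) {s : ℂ}
    (hs : s ∉ gasRegion (quadratureDomain N₁ d₀ d₁ ρ) (quadratureDomain N₂ d₀ d₁ ρ)) :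
    upperTransform x t (quadratureDomain N₁ d₀ d₁ ρ) (density N₁ d₀ ϖ₁) s
       - upperTransform x t (mirror (quadratureDomain N₁ d₀ d₁ ρ))
          (fun w => conj (density N₁ d₀ ϖ₁ (-conj w))) s
       + upperTransform x t (quadratureDomain N₂ d₀ d₁ ρ) (density N₂ d₀ ϖ₂) s =
      poleSum (finite_upperPoles z κ).toFinset
        (phasedConstant x t z (shieldedConstant ρ ϖ₁ z) κ (shieldedConstant ρ ϖ₂ κ)) s := by
  have hs1 : s ∉ quadratureDomain N₁ d₀ d₁ ρ := fun h => hs (Or.inl (Or.inl h))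
  have hs2 : -conj s ∉ quadratureDomain N₁ d₀ d₁ ρ := fun h => hs (Or.inl (Or.inr h))
  have hs3 : s ∉ quadratureDomain N₂ d₀ d₁ ρ := fun h => hs (Or.inr h)
  rw [upperTransform_mirror, upperTransform_density x t hd₁ hρ hϖ₁ hz hzr hs1,
    upperTransform_density x t hd₁ hρ hϖ₁ hz hzr hs2,
    upperTransform_density x t hd₁ hρ hϖ₂ hκ hκr hs3]
  have := sum_normingConstant_mul z (shieldedConstant ρ ϖ₁ z) κ (shieldedConstant ρ ϖ₂ κ)
    fun p => Complex.exp (2 * Complex.I * phase x t p) / (p - s)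
  simp only [poleSum, phasedConstant, mul_div_assoc]
  rw [this]
  congr 2
  rw [map_sum, ← Finset.sum_neg_distrib]
  refine Finset.sum_congr rfl fun k _ => ?_
  rw [map_mul, map_div₀, ← mul_neg, ← div_neg]
  congr 2
  · have := conj_exp_phase_neg_conj x t (-conj (z k))
    rw [map_neg, Complex.conj_conj, neg_neg] at this
    exact this
  · simp only [map_sub, map_neg, Complex.conj_conj]
    ring

/-- Schwarz symmetry of the jump matrices. -/
lemma lowerJump_entry (x t : ℝ) (D₁ D₂ : Set ℂ) (α₁ α₂ : ℂ → ℂ) (s : ℂ) :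
    lowerTransform x t (conjSet D₁) (fun w => conj (α₁ (conj w))) s
       - lowerTransform x t (conjSet (mirror D₁)) (fun w => α₁ (-w)) s
       + lowerTransform x t (conjSet D₂) (fun w => conj (α₂ (conj w))) s =
      -conj (upperTransform x t D₁ α₁ (conj s)
       - upperTransform x t (mirror D₁) (fun w => conj (α₁ (-conj w))) (conj s)
       + upperTransform x t D₂ α₂ (conj s)) := by
  have h := lowerTransform_conjSet x t (mirror D₁) (fun w => conj (α₁ (-conj w))) s
  simp only [Complex.conj_conj] at h
  rw [lowerTransform_conjSet, lowerTransform_conjSet, h]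
  simp only [map_add, map_sub]
  ring

end Jumps

/-! ### Residue conditions as limits -/

/-- A residue condition with a nilpotent matrix `R` says exactly that `M (1 - R / (z - p))` has a
limit at `p`. -/
lemma hasResidueCondition_iff {p : ℂ} {R : Matrix (Fin 2) (Fin 2) ℂ} (hR : R * R = 0)
    {M : ℂ → Matrix (Fin 2) (Fin 2) ℂ}
    (hM : ∀ᶠ z in 𝓝[≠] p, ∀ i j, DifferentiableAt ℂ (fun z => M z i j) z) :
    HasResidueCondition p R M ↔
      ∃ L, Tendsto (fun z => M z * (1 - (z - p)⁻¹ • R)) (𝓝[≠] p) (𝓝 L) := by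
  have hne : ∀ᶠ z in 𝓝[≠] p, z - p ≠ 0 := by
    filter_upwards [self_mem_nhdsWithin] with z hz using sub_ne_zero.2 hz
  constructor
  · rintro ⟨A, h1, h2⟩
    have h3 : Tendsto (fun z => (z - p) • (M z * (1 - (z - p)⁻¹ • R))) (𝓝[≠] p) (𝓝 0) := by
      have h4 := h1.sub h2
      rw [sub_self] at h4
      refine h4.congr' ?_
      filter_upwards [hne] with z hz
      rw [mul_sub, mul_one, smul_sub, mul_smul_comm, smul_smul, mul_inv_cancel₀ hz, one_smul]
    have hent : ∀ i j, ∃ y, Tendsto (fun z => (M z * (1 - (z - p)⁻¹ • R)) i j) (𝓝[≠] p) (𝓝 y) := by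
      intro i j
      refine ⟨_, Complex.tendsto_limUnder_of_differentiable_on_punctured_nhds_of_isLittleO ?_ ?_⟩
      · filter_upwards [hM, hne] with z hz hz0
        have hinv : ∀ k l, DifferentiableAt ℂ
            (fun z => (1 - (z - p)⁻¹ • R : Matrix (Fin 2) (Fin 2) ℂ) k l) z := by
          intro k l
          simp only [Matrix.sub_apply, Matrix.smul_apply, smul_eq_mul]
          exact (differentiableAt_const _).sub
            (((differentiableAt_id.sub_const p).inv hz0).mul_const _)
        simp only [Matrix.mul_apply]
        exact DifferentiableAt.fun_sum fun k _ => (hz i k).mul (hinv k j)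
      · rw [Asymptotics.isLittleO_iff_tendsto' (by
          filter_upwards [hne] with z hz h using absurd h (inv_ne_zero hz))]
        have h5 : Tendsto (fun z => (z - p) * (M z * (1 - (z - p)⁻¹ • R)) i j) (𝓝[≠] p) (𝓝 0) :=
          (tendsto_pi_nhds.1 (tendsto_pi_nhds.1 h3 i) j)
        have h6 : Tendsto (fun z : ℂ => (z - p) * (M p * (1 - (p - p)⁻¹ • R)) i j) (𝓝[≠] p)
            (𝓝 0) := by
          have : Continuous fun z : ℂ => (z - p) * (M p * (1 - (p - p)⁻¹ • R)) i j := by fun_prop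
          simpa using (this.tendsto p).mono_left nhdsWithin_le_nhds
        have h7 := h5.sub h6
        rw [sub_zero] at h7
        refine h7.congr fun z => ?_
        rw [div_inv_eq_mul]
        ring
    choose y hy using hent
    exact ⟨Matrix.of y, tendsto_pi_nhds.2 fun i => tendsto_pi_nhds.2 fun j => hy i j⟩
  · rintro ⟨L, hL⟩
    have hinv : ∀ a : ℂ, (1 - a • R) * (1 + a • R) = 1 := fun a => by
      rw [sub_mul, mul_add, mul_add, smul_mul_smul, hR]; simp
    refine ⟨L * R, ?_, ?_⟩
    · have h1 : Tendsto (fun z : ℂ => (z - p) • (1 : Matrix (Fin 2) (Fin 2) ℂ) + R) (𝓝[≠] p)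
          (𝓝 R) := by
        have : Continuous fun z : ℂ => (z - p) • (1 : Matrix (Fin 2) (Fin 2) ℂ) + R := by fun_prop
        simpa using (this.tendsto p).mono_left nhdsWithin_le_nhds
      refine (hL.mul h1).congr' ?_
      filter_upwards [hne] with z hz
      have h2 : (z - p) • (1 : Matrix (Fin 2) (Fin 2) ℂ) + R = (z - p) • (1 + (z - p)⁻¹ • R) := by
        rw [smul_add, smul_smul, mul_inv_cancel₀ hz, one_smul]
      rw [h2, mul_smul_comm, mul_assoc, hinv, mul_one]
    · refine (hL.mul_const R).congr fun z => ?_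
      rw [mul_assoc, sub_mul, smul_mul_assoc, hR, smul_zero, sub_zero, one_mul]

/-- Multiplication by an invertible factor does not affect the existence of a limit. -/
lemma exists_tendsto_mul_iff {l : Filter ℂ} {F G G' : ℂ → Matrix (Fin 2) (Fin 2) ℂ}
    {A A' : Matrix (Fin 2) (Fin 2) ℂ} (hG : Tendsto G l (𝓝 A)) (hG' : Tendsto G' l (𝓝 A'))
    (h : ∀ z, G z * G' z = 1) :
    (∃ L, Tendsto F l (𝓝 L)) ↔ ∃ L, Tendsto (fun z => F z * G z) l (𝓝 L) := by
  constructor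
  · rintro ⟨L, hL⟩
    exact ⟨L * A, hL.mul hG⟩
  · rintro ⟨L, hL⟩
    refine ⟨L * A', (hL.mul hG').congr fun z => ?_⟩
    rw [mul_assoc, h, mul_one]

/-! ### Normalised matrices -/

lemma isOpen_conjSet {U : Set ℂ} (hU : IsOpen U) : IsOpen (conjSet U) :=
  hU.preimage Complex.continuous_conj

lemma isBounded_conjSet {U : Set ℂ} (hU : Bornology.IsBounded U) :
    Bornology.IsBounded (conjSet U) := by
  obtain ⟨R, hR⟩ := hU.subset_closedBall 0
  refine (Metric.isBounded_closedBall (x := (0 : ℂ)) (r := R)).subset fun w hw => ?_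
  have := hR hw
  simpa using this

lemma closure_conjSet (U : Set ℂ) : closure (conjSet U) = conjSet (closure U) :=
  (Complex.conjLIE.toHomeomorph.preimage_closure U).symm

lemma IsNormalized.mono {Γ Γ' : Set ℂ} {M : ℂ → Matrix (Fin 2) (Fin 2) ℂ}
    (h : IsNormalized Γ M) (hΓ : Γ ⊆ Γ') : IsNormalized Γ' M where
  analytic i j := (h.analytic i j).mono (Set.compl_subset_compl.2 hΓ)
  det_eq_one z hz := h.det_eq_one z fun hz' => hz (hΓ hz')
  asymptotics := h.asymptotics

lemma IsNormalized.differentiableAt {Γ : Set ℂ} {M : ℂ → Matrix (Fin 2) (Fin 2) ℂ}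
    (h : IsNormalized Γ M) (hΓ : IsClosed Γ) {z : ℂ} (hz : z ∉ Γ) (i j : Fin 2) :
    DifferentiableAt ℂ (fun z => M z i j) z :=
  (h.analytic i j).differentiableAt (hΓ.isOpen_compl.mem_nhds hz)

lemma IsNormalized.continuousAt {Γ : Set ℂ} {M : ℂ → Matrix (Fin 2) (Fin 2) ℂ}
    (h : IsNormalized Γ M) (hΓ : IsClosed Γ) {z : ℂ} (hz : z ∉ Γ) : ContinuousAt M z :=
  tendsto_pi_nhds.2 fun i => tendsto_pi_nhds.2 fun j =>
    (h.differentiableAt hΓ hz i j).continuousAt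

lemma IsNormalized.tendsto_one {Γ : Set ℂ} {M : ℂ → Matrix (Fin 2) (Fin 2) ℂ}
    (h : IsNormalized Γ M) : Tendsto M (Bornology.cobounded ℂ) (𝓝 1) := by
  refine tendsto_pi_nhds.2 fun i => tendsto_pi_nhds.2 fun j => ?_
  have h1 := (h.asymptotics i j).trans_tendsto (tendsto_inv₀_cobounded (α := ℂ))
  simpa using h1.add_const ((1 : Matrix (Fin 2) (Fin 2) ℂ) i j)

/-- A normalised matrix extends over a removable set at whose points it has limits. -/
lemma IsNormalized.extend {Γ K : Set ℂ} {M : ℂ → Matrix (Fin 2) (Fin 2) ℂ}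
    (h : IsNormalized (Γ ∪ K) M) (hΓ : IsClosed Γ) (hΓb : Bornology.IsBounded Γ)
    (hK : ContRemovable K) (hKb : Bornology.IsBounded K)
    (hl : ∀ s ∈ K, s ∉ Γ → ∃ L, Tendsto M (𝓝[Kᶜ] s) (𝓝 L)) :
    ∃ M' : ℂ → Matrix (Fin 2) (Fin 2) ℂ, IsNormalized Γ M' ∧ ∀ z ∈ (Γ ∪ K)ᶜ, M' z = M z := by
  have hset : (Γ ∪ K)ᶜ = Γᶜ \ K := by rw [Set.compl_union]; rfl
  have hext : ∀ i j, DifferentiableOn ℂ (extendFrom Kᶜ fun z => M z i j) Γᶜ ∧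
      ∀ z ∈ Γᶜ \ K, extendFrom Kᶜ (fun z => M z i j) z = M z i j := by
    intro i j
    refine hK.extend hΓ.isOpen_compl (by rw [← hset]; exact h.analytic i j) ?_
    rintro s ⟨hsΓ, hsK⟩
    obtain ⟨L, hL⟩ := hl s hsK hsΓ
    exact ⟨L i j, tendsto_pi_nhds.1 (tendsto_pi_nhds.1 hL i) j⟩
  set M' : ℂ → Matrix (Fin 2) (Fin 2) ℂ :=
    fun z => Matrix.of fun i j => extendFrom Kᶜ (fun z => M z i j) z
  have heq : ∀ z ∈ (Γ ∪ K)ᶜ, M' z = M z := fun z hz => by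
    ext i j
    exact (hext i j).2 z (by rwa [← hset])
  refine ⟨M', ⟨fun i j => (hext i j).1, fun z hz => ?_, fun i j => ?_⟩, heq⟩
  · have hc : ContinuousOn (fun z => (M' z).det) Γᶜ := by
      simp only [Matrix.det_fin_two]
      exact (((hext 0 0).1.continuousOn).mul ((hext 1 1).1.continuousOn)).sub
        (((hext 0 1).1.continuousOn).mul ((hext 1 0).1.continuousOn))
    have : Set.EqOn (fun z => (M' z).det) (fun _ => 1) (Γᶜ ∩ Kᶜ) := fun w hw => by
      have hw' : w ∈ (Γ ∪ K)ᶜ := by rw [hset]; exact hw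
      simp only [heq w hw']
      exact h.det_eq_one w hw'
    exact (this.of_subset_closure hc continuousOn_const Set.inter_subset_left
      (hK.dense_compl.open_subset_closure_inter hΓ.isOpen_compl)) hz
  · refine (h.asymptotics i j).congr' ?_ EventuallyEq.rfl
    have : ∀ᶠ z in Bornology.cobounded ℂ, z ∈ (Γ ∪ K)ᶜ := (hΓb.union hKb)
    filter_upwards [this] with z hz
    rw [heq z hz]

/-! ### The Riemann-Hilbert problem with finitely many poles: uniqueness -/

/-- The Riemann-Hilbert problem with simple poles at the points `p ∈ S` and at their conjugates,
with residue data `γ`: the multi-soliton problem with the phase factors absorbed in `γ`. -/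
structure IsPoleRHSolution (S : Finset ℂ) (γ : ℂ → ℂ) (M : ℂ → Matrix (Fin 2) (Fin 2) ℂ) :
    Prop where
  normalized : IsNormalized ((S : Set ℂ) ∪ conjSet S) M
  residue_upper : ∀ p ∈ S, HasResidueCondition p !![0, 0; γ p, 0] M
  residue_lower : ∀ p ∈ S, HasResidueCondition (conj p) !![0, -conj (γ p); 0, 0] M

lemma finite_conjSet {S : Set ℂ} (hS : S.Finite) : (conjSet S).Finite :=
  hS.preimage (starRingEnd ℂ).injective.injOn

lemma finite_poles (S : Finset ℂ) : ((S : Set ℂ) ∪ conjSet S).Finite :=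
  S.finite_toSet.union (finite_conjSet S.finite_toSet)

lemma lowerResidue_mul_self (a : ℂ) : (!![0, 0; a, 0] * !![0, 0; a, 0] :
    Matrix (Fin 2) (Fin 2) ℂ) = 0 := by
  ext i j; fin_cases i <;> fin_cases j <;> simp

lemma upperResidue_mul_self (a : ℂ) : (!![0, a; 0, 0] * !![0, a; 0, 0] :
    Matrix (Fin 2) (Fin 2) ℂ) = 0 := by
  ext i j; fin_cases i <;> fin_cases j <;> simp

lemma eventually_punctured {P : Set ℂ} (hP : P.Finite) {φ : ℂ → Prop} (h : ∀ z ∉ P, φ z) (s : ℂ) :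
    ∀ᶠ z in 𝓝[≠] s, φ z := by
  have hcl : IsClosed (P \ {s}) := (hP.subset Set.sdiff_subset).isClosed
  have : (P \ {s})ᶜ ∈ 𝓝 s := hcl.isOpen_compl.mem_nhds (by simp)
  filter_upwards [nhdsWithin_le_nhds this, self_mem_nhdsWithin] with z hz hzs
  exact h z fun h => hz ⟨h, hzs⟩

/-- At every pole, the residue condition is given by a nilpotent matrix `R`, which also satisfies
`det (1 - a R) = 1`. -/
lemma exists_residueMatrix (S : Finset ℂ) (γ : ℂ → ℂ) {s : ℂ} (hs : s ∈ (S : Set ℂ) ∪ conjSet S) :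
    ∃ R : Matrix (Fin 2) (Fin 2) ℂ, R * R = 0 ∧ (∀ a : ℂ, (1 - a • R).det = 1) ∧
      ∀ M : ℂ → Matrix (Fin 2) (Fin 2) ℂ,
        (∀ p ∈ S, HasResidueCondition p !![0, 0; γ p, 0] M) →
        (∀ p ∈ S, HasResidueCondition (conj p) !![0, -conj (γ p); 0, 0] M) →
        HasResidueCondition s R M := by
  rcases hs with hs | hs
  · refine ⟨!![0, 0; γ s, 0], lowerResidue_mul_self _, fun a => ?_, fun M hu _ => hu s hs⟩
    simp [Matrix.det_fin_two]
  · refine ⟨!![0, -conj (γ (conj s)); 0, 0], upperResidue_mul_self _, fun a => ?_,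
      fun M _ hl => ?_⟩
    · simp [Matrix.det_fin_two]
    · simpa using hl (conj s) hs

/-- A function holomorphic off a finite set, with limits there and at infinity, is constant. -/
lemma eq_of_finite_of_tendsto {P : Set ℂ} (hP : P.Finite) {f : ℂ → ℂ} {c : ℂ}
    (hd : ∀ z ∉ P, DifferentiableAt ℂ f z) (hl : ∀ s ∈ P, ∃ y, Tendsto f (𝓝[≠] s) (𝓝 y))
    (hc : Tendsto f (Bornology.cobounded ℂ) (𝓝 c)) : ∀ z ∉ P, f z = c := by
  obtain ⟨h1, h2⟩ := (ContRemovable.of_finite hP).extend isOpen_univ (f := f)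
    (fun z hz => (hd z hz.2).differentiableWithinAt) (by
      rintro s ⟨-, hs⟩
      obtain ⟨y, hy⟩ := hl s hs
      exact ⟨y, hy.mono_left (nhdsWithin_mono s fun z hz h => hz (by
        rw [Set.mem_singleton_iff.1 h]; exact hs))⟩)
  have h3 : Tendsto (extendFrom Pᶜ f) (cocompact ℂ) (𝓝 c) := by
    rw [← Metric.cobounded_eq_cocompact]
    refine hc.congr' ?_
    have : ∀ᶠ z in Bornology.cobounded ℂ, z ∈ Pᶜ := hP.isBounded
    filter_upwards [this] with z hz using (h2 z ⟨trivial, hz⟩).symm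
  intro z hz
  rw [← h2 z ⟨trivial, hz⟩]
  exact (differentiableOn_univ.1 h1).apply_eq_of_tendsto_cocompact z h3

/-- The pole problem has at most one solution: the quotient of two solutions is entire and tends to
the identity at infinity. -/
lemma IsPoleRHSolution.unique {S : Finset ℂ} {γ : ℂ → ℂ} {M₁ M₂ : ℂ → Matrix (Fin 2) (Fin 2) ℂ}
    (h₁ : IsPoleRHSolution S γ M₁) (h₂ : IsPoleRHSolution S γ M₂) :
    ∀ z ∉ ((S : Set ℂ) ∪ conjSet S), M₁ z = M₂ z := by
  have hP := finite_poles S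
  have hd₁ := fun z hz => h₁.normalized.differentiableAt hP.isClosed (z := z) hz
  have hd₂ := fun z hz => h₂.normalized.differentiableAt hP.isClosed (z := z) hz
  have hadj : ∀ z, (M₂ z).adjugate = !![M₂ z 1 1, -M₂ z 0 1; -M₂ z 1 0, M₂ z 0 0] := fun z =>
    Matrix.adjugate_fin_two _
  have hadjd : ∀ z ∉ ((S : Set ℂ) ∪ conjSet S), ∀ i j,
      DifferentiableAt ℂ (fun z => (M₂ z).adjugate i j) z := by
    intro z hz i j
    simp only [hadj]
    have h00 := hd₂ z hz 0 0
    have h01 := hd₂ z hz 0 1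
    have h10 := hd₂ z hz 1 0
    have h11 := hd₂ z hz 1 1
    fin_cases i <;> fin_cases j <;> simp <;> assumption
  have hconst : ∀ i j, ∀ z ∉ ((S : Set ℂ) ∪ conjSet S),
      (M₁ z * (M₂ z).adjugate) i j = (1 : Matrix (Fin 2) (Fin 2) ℂ) i j := by
    intro i j
    refine eq_of_finite_of_tendsto (f := fun z => (M₁ z * (M₂ z).adjugate) i j) hP ?_ ?_ ?_
    · intro z hz
      simp only [Matrix.mul_apply]
      exact DifferentiableAt.fun_sum fun k _ => (hd₁ z hz i k).mul (hadjd z hz k j)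
    · intro s hs
      obtain ⟨R, hRR, hdet, hR⟩ := exists_residueMatrix S γ hs
      obtain ⟨L₁, hL₁⟩ := (hasResidueCondition_iff hRR (eventually_punctured hP hd₁ s)).1
        (hR M₁ h₁.residue_upper h₁.residue_lower)
      obtain ⟨L₂, hL₂⟩ := (hasResidueCondition_iff hRR (eventually_punctured hP hd₂ s)).1
        (hR M₂ h₂.residue_upper h₂.residue_lower)
      have hcont : Continuous fun A : Matrix (Fin 2) (Fin 2) ℂ => A.adjugate :=
        continuous_id.matrix_adjugate
      have hlim := hL₁.mul ((hcont.tendsto L₂).comp hL₂)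
      refine ⟨_, tendsto_pi_nhds.1 (tendsto_pi_nhds.1 (hlim.congr fun z => ?_) i) j⟩
      simp only [Function.comp]
      rw [Matrix.adjugate_mul_distrib, mul_assoc, ← mul_assoc _ _ (M₂ z).adjugate,
        Matrix.mul_adjugate, hdet, one_smul, one_mul]
    · have hcont : Continuous fun A : Matrix (Fin 2) (Fin 2) ℂ => A.adjugate :=
        continuous_id.matrix_adjugate
      have := h₁.normalized.tendsto_one.mul
        ((hcont.tendsto 1).comp h₂.normalized.tendsto_one)
      rw [Matrix.adjugate_one, mul_one] at this
      exact tendsto_pi_nhds.1 (tendsto_pi_nhds.1 this i) j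
  intro z hz
  have h3 : M₁ z * (M₂ z).adjugate = 1 := by
    ext i j; exact hconst i j z hz
  calc M₁ z = M₁ z * ((M₂ z).adjugate * M₂ z) := by
        rw [Matrix.adjugate_mul, h₂.normalized.det_eq_one z hz, one_smul, mul_one]
    _ = M₂ z := by rw [← mul_assoc, h3, one_mul]

lemma HasPotential.congr {M₁ M₂ : ℂ → Matrix (Fin 2) (Fin 2) ℂ} {q : ℂ} (h : HasPotential M₁ q)
    {B : Set ℂ} (hB : Bornology.IsBounded B) (heq : ∀ z ∉ B, M₁ z = M₂ z) : HasPotential M₂ q := by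
  refine Tendsto.congr' ?_ h
  have : ∀ᶠ z in Bornology.cobounded ℂ, z ∈ Bᶜ := hB
  filter_upwards [this] with z hz
  rw [heq z hz]

/-! ### The Riemann-Hilbert problem with finitely many poles: existence -/

section Existence

open Polynomial in
/-- Simple fractions with distinct poles off the real line are linearly independent on it. -/
lemma eq_zero_of_sum_div_eq_zero {ι : Type*} [Fintype ι] {v a : ι → ℂ}
    (hv : Function.Injective v) (hi : ∀ i, (v i).im ≠ 0)
    (h : ∀ x : ℝ, ∑ i, a i / ((x : ℂ) - v i) = 0) : a = 0 := by
  classical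
  set Q : ℂ[X] := ∑ i, C (a i) * ∏ j ∈ Finset.univ.erase i, (X - C (v j)) with hQ
  have hne : ∀ (x : ℝ) i, (x : ℂ) - v i ≠ 0 := fun x i h0 => hi i (by
    rw [← sub_eq_zero.1 h0, Complex.ofReal_im])
  have hroot : ∀ x : ℝ, Q.IsRoot x := by
    intro x
    have : Q.eval (x : ℂ) = (∏ j, ((x : ℂ) - v j)) * ∑ i, a i / ((x : ℂ) - v i) := by
      rw [hQ, eval_finsetSum, Finset.mul_sum]
      refine Finset.sum_congr rfl fun i _ => ?_
      rw [← Finset.mul_prod_erase _ _ (Finset.mem_univ i)]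
      simp only [eval_mul, eval_C, eval_prod, eval_sub, eval_X]
      field_simp [hne x i]
    rw [IsRoot, this, h x, mul_zero]
  have hQ0 : Q = 0 := by
    refine eq_zero_of_infinite_isRoot Q (Set.Infinite.mono ?_
      (Set.infinite_range_of_injective Complex.ofReal_injective))
    rintro _ ⟨x, rfl⟩
    exact hroot x
  funext i
  have h1 : Q.eval (v i) = a i * ∏ j ∈ Finset.univ.erase i, (v i - v j) := by
    rw [hQ, eval_finsetSum, Finset.sum_eq_single i]
    · simp [eval_prod]
    · intro k _ hk
      rw [eval_mul, eval_prod,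
        Finset.prod_eq_zero (Finset.mem_erase.2 ⟨hk.symm, Finset.mem_univ i⟩), mul_zero]
      simp
    · simp
  rw [hQ0, eval_zero] at h1
  refine (mul_eq_zero.1 h1.symm).resolve_right (Finset.prod_ne_zero_iff.2 fun j hj => ?_)
  exact sub_ne_zero.2 fun h => (Finset.ne_of_mem_erase hj) (hv h.symm)

/-- The vanishing lemma: the homogeneous linear system has only the zero solution. With
`X₁ = ∑ a_p / (x - p)` and `X₂ = ∑ b_p / (x - p̄)`, a partial fraction expansion of
`|X₁|² + |X₂|²` on the real line shows that it vanishes identically. -/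
lemma homogeneous_eq_zero {ι : Type*} [Fintype ι] {v γ a b : ι → ℂ}
    (hv : Function.Injective v) (hi : ∀ i, 0 < (v i).im)
    (ha : ∀ i, a i = γ i * ∑ j, b j / (v i - conj (v j)))
    (hb : ∀ i, b i = -conj (γ i) * ∑ j, a j / (conj (v i) - v j)) : a = 0 ∧ b = 0 := by
  have hne : ∀ i j, v i - conj (v j) ≠ 0 := fun i j h => by
    have h1 := congrArg Complex.im h
    simp only [Complex.sub_im, Complex.conj_im, Complex.zero_im] at h1
    linarith [hi i, hi j]
  have hx1 : ∀ (x : ℝ) i, (x : ℂ) - v i ≠ 0 := fun x i h => by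
    have h1 := congrArg Complex.im h
    simp only [Complex.sub_im, Complex.ofReal_im, Complex.zero_im] at h1
    linarith [hi i]
  have hx2 : ∀ (x : ℝ) i, (x : ℂ) - conj (v i) ≠ 0 := fun x i h => by
    have h1 := congrArg Complex.im h
    simp only [Complex.sub_im, Complex.ofReal_im, Complex.zero_im, Complex.conj_im] at h1
    linarith [hi i]
  set Y : ι → ℂ := fun i => ∑ j, a j / (conj (v i) - v j) with hY
  set Z : ι → ℂ := fun i => ∑ j, b j / (v i - conj (v j)) with hZ
  have key : ∀ x : ℝ, (∑ i, a i / ((x : ℂ) - v i)) = 0 ∧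
      (∑ i, b i / ((x : ℂ) - conj (v i))) = 0 := by
    intro x
    set X₁ := ∑ i, a i / ((x : ℂ) - v i) with hX₁
    set X₂ := ∑ i, b i / ((x : ℂ) - conj (v i)) with hX₂
    have e1 : X₁ * conj X₁ = ∑ i, a i * conj (Y i) / (x - v i) +
        ∑ i, conj (a i) * Y i / (x - conj (v i)) := by
      have l1 : X₁ * conj X₁ = ∑ i, ∑ j,
          (a i * conj (a j) / (v i - conj (v j)) / (x - v i) +
            conj (a j) * (a i / (conj (v j) - v i)) / (x - conj (v j))) := by
        rw [hX₁, map_sum, Finset.sum_mul_sum]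
        refine Finset.sum_congr rfl fun i _ => Finset.sum_congr rfl fun j _ => ?_
        rw [map_div₀, map_sub, Complex.conj_ofReal]
        have := hne i j
        have := hx1 x i
        have := hx2 x j
        rw [show conj (v j) - v i = -(v i - conj (v j)) by ring]
        field_simp
        ring
      rw [l1]
      simp only [Finset.sum_add_distrib]
      congr 1
      · refine Finset.sum_congr rfl fun i _ => ?_
        rw [hY]
        simp only [map_sum, map_div₀, map_sub, Complex.conj_conj]
        rw [Finset.mul_sum, Finset.sum_div]
        exact Finset.sum_congr rfl fun j _ => by rw [mul_div_assoc]
      · rw [Finset.sum_comm]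
        refine Finset.sum_congr rfl fun j _ => ?_
        rw [hY]
        simp only [Finset.mul_sum, Finset.sum_div]
    have e2 : X₂ * conj X₂ = ∑ i, conj (b i) * Z i / (x - v i) +
        ∑ i, b i * conj (Z i) / (x - conj (v i)) := by
      have l1 : X₂ * conj X₂ = ∑ i, ∑ j,
          (conj (b j) * (b i / (v j - conj (v i))) / (x - v j) +
            b i * (conj (b j) / (conj (v i) - v j)) / (x - conj (v i))) := by
        rw [hX₂, map_sum, Finset.sum_mul_sum]
        refine Finset.sum_congr rfl fun i _ => Finset.sum_congr rfl fun j _ => ?_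
        rw [map_div₀, map_sub, Complex.conj_ofReal, Complex.conj_conj]
        have := hne j i
        have := hx1 x j
        have := hx2 x i
        rw [show conj (v i) - v j = -(v j - conj (v i)) by ring]
        field_simp
        ring
      rw [l1]
      simp only [Finset.sum_add_distrib]
      congr 1
      · rw [Finset.sum_comm]
        refine Finset.sum_congr rfl fun i _ => ?_
        rw [hZ]
        simp only [Finset.mul_sum, Finset.sum_div]
      · refine Finset.sum_congr rfl fun i _ => ?_
        rw [hZ]
        simp only [map_sum, map_div₀, map_sub, Complex.conj_conj]
        rw [Finset.mul_sum, Finset.sum_div]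
    have e3 : X₁ * conj X₁ + X₂ * conj X₂ = 0 := by
      rw [e1, e2]
      have l1 : ∑ i, a i * conj (Y i) / (x - v i) + ∑ i, conj (b i) * Z i / (x - v i) = 0 := by
        rw [← Finset.sum_add_distrib]
        refine Finset.sum_eq_zero fun i _ => ?_
        rw [ha i, hb i, map_mul, map_neg, Complex.conj_conj]
        ring
      have l2 : ∑ i, conj (a i) * Y i / (x - conj (v i)) +
          ∑ i, b i * conj (Z i) / (x - conj (v i)) = 0 := by
        rw [← Finset.sum_add_distrib]
        refine Finset.sum_eq_zero fun i _ => ?_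
        rw [ha i, hb i, map_mul]
        ring
      linear_combination l1 + l2
    rw [Complex.mul_conj, Complex.mul_conj, ← Complex.ofReal_add, Complex.ofReal_eq_zero] at e3
    have p1 := Complex.normSq_nonneg X₁
    have p2 := Complex.normSq_nonneg X₂
    exact ⟨Complex.normSq_eq_zero.1 (by linarith), Complex.normSq_eq_zero.1 (by linarith)⟩
  refine ⟨eq_zero_of_sum_div_eq_zero hv (fun i => (hi i).ne') fun x => (key x).1,
    eq_zero_of_sum_div_eq_zero (v := fun i => conj (v i))
      ((starRingEnd ℂ).injective.comp hv) (fun i => ?_) fun x => (key x).2⟩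
  rw [Complex.conj_im]
  exact neg_ne_zero.2 (hi i).ne'

/-- The linear system for the residues of one row of the solution. -/
lemma exists_residues {ι : Type*} [Fintype ι] {v : ι → ℂ} (γ : ι → ℂ)
    (hv : Function.Injective v) (hi : ∀ i, 0 < (v i).im) (c₁ c₂ : ℂ) :
    ∃ a b : ι → ℂ, (∀ i, a i = γ i * (c₂ + ∑ j, b j / (v i - conj (v j)))) ∧
      ∀ i, b i = -conj (γ i) * (c₁ + ∑ j, a j / (conj (v i) - v j)) := by
  let T : ((ι → ℂ) × (ι → ℂ)) →ₗ[ℂ] ((ι → ℂ) × (ι → ℂ)) :=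
    { toFun := fun ab => (fun i => ab.1 i - γ i * ∑ j, ab.2 j / (v i - conj (v j)),
        fun i => ab.2 i + conj (γ i) * ∑ j, ab.1 j / (conj (v i) - v j))
      map_add' := fun x y => by
        ext i
        · simp only [Prod.fst_add, Prod.snd_add, Pi.add_apply, add_div, Finset.sum_add_distrib]
          ring
        · simp only [Prod.fst_add, Prod.snd_add, Pi.add_apply, add_div, Finset.sum_add_distrib]
          ring
      map_smul' := fun r x => by
        ext i
        · simp only [Prod.smul_fst, Prod.smul_snd, Pi.smul_apply, smul_eq_mul, mul_div_assoc,
            ← Finset.mul_sum, RingHom.id_apply]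
          ring
        · simp only [Prod.smul_fst, Prod.smul_snd, Pi.smul_apply, smul_eq_mul, mul_div_assoc,
            ← Finset.mul_sum, RingHom.id_apply]
          ring }
  have hinj : Function.Injective T := by
    refine (injective_iff_map_eq_zero T).2 fun ab h => ?_
    have h1 := fun i => congrFun (congrArg Prod.fst h) i
    have h2 := fun i => congrFun (congrArg Prod.snd h) i
    obtain ⟨e1, e2⟩ := homogeneous_eq_zero (γ := γ) hv hi (fun i => sub_eq_zero.1 (h1 i))
      (fun i => by rw [neg_mul]; exact eq_neg_of_add_eq_zero_left (h2 i))
    exact Prod.ext e1 e2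
  obtain ⟨⟨a, b⟩, hab⟩ := (LinearMap.injective_iff_surjective.1 hinj)
    (fun i => γ i * c₂, fun i => -conj (γ i) * c₁)
  refine ⟨a, b, fun i => ?_, fun i => ?_⟩
  · have h1 : a i - γ i * ∑ j, b j / (v i - conj (v j)) = γ i * c₂ :=
      congrFun (congrArg Prod.fst hab) i
    linear_combination h1
  · have h2 : b i + conj (γ i) * ∑ j, a j / (conj (v i) - v j) = -conj (γ i) * c₁ :=
      congrFun (congrArg Prod.snd hab) i
    linear_combination h2

lemma tendsto_mul_inv_sub (p : ℂ) :
    Tendsto (fun z : ℂ => z * (z - p)⁻¹) (Bornology.cobounded ℂ) (𝓝 1) := by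
  have h1 : Tendsto (fun z : ℂ => z - p) (Bornology.cobounded ℂ) (Bornology.cobounded ℂ) := by
    rw [← tendsto_norm_atTop_iff_cobounded]
    refine tendsto_atTop_mono (fun z => norm_sub_norm_le z p) ?_
    exact tendsto_atTop_add_const_right _ _ tendsto_norm_cobounded_atTop
  have h2 := ((tendsto_inv₀_cobounded (α := ℂ)).comp h1).const_mul p |>.const_add 1
  rw [mul_zero, add_zero] at h2
  refine h2.congr' ?_
  have : ∀ᶠ z in Bornology.cobounded ℂ, z ∈ ({p} : Set ℂ)ᶜ := Bornology.isBounded_singleton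
  filter_upwards [this] with z hz
  have : z - p ≠ 0 := sub_ne_zero.2 hz
  simp only [Function.comp]
  field_simp
  ring

lemma tendsto_mul_sum_div {ι : Type*} [Fintype ι] (v a : ι → ℂ) :
    Tendsto (fun z : ℂ => z * ∑ i, a i / (z - v i)) (Bornology.cobounded ℂ) (𝓝 (∑ i, a i)) := by
  have := tendsto_finsetSum Finset.univ fun i _ => (tendsto_mul_inv_sub (v i)).const_mul (a i)
  simp only [mul_one] at this
  refine this.congr fun z => ?_
  rw [Finset.mul_sum]
  exact Finset.sum_congr rfl fun i _ => by rw [div_eq_mul_inv]; ring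

lemma isBigO_sum_div {ι : Type*} [Fintype ι] (v a : ι → ℂ) :
    (fun z : ℂ => ∑ i, a i / (z - v i)) =O[Bornology.cobounded ℂ] fun z => z⁻¹ := by
  have h := (tendsto_mul_sum_div v a).isBigO_one ℂ
  have h2 := h.mul (Asymptotics.isBigO_refl (fun z : ℂ => z⁻¹) (Bornology.cobounded ℂ))
  refine (h2.congr' ?_ ?_)
  · have : ∀ᶠ z in Bornology.cobounded ℂ, z ∈ ({0} : Set ℂ)ᶜ := Bornology.isBounded_singleton
    filter_upwards [this] with z hz
    have hz' : z ≠ 0 := hz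
    field_simp
  · exact Eventually.of_forall fun z => one_mul _

lemma differentiableAt_sum_div {ι : Type*} [Fintype ι] {v : ι → ℂ} (a : ι → ℂ) {z : ℂ}
    (hz : ∀ i, z ≠ v i) : DifferentiableAt ℂ (fun z => ∑ i, a i / (z - v i)) z :=
  DifferentiableAt.fun_sum fun i _ =>
    (differentiableAt_const _).div (differentiableAt_id.sub_const _) (sub_ne_zero.2 (hz i))

/-- The residue of a sum of simple fractions. -/
lemma tendsto_sub_mul_sum_div {ι : Type*} [Fintype ι] {v : ι → ℂ} (hv : Function.Injective v)
    (a : ι → ℂ) (c : ℂ) (k : ι) :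
    Tendsto (fun z => (z - v k) * (c + ∑ i, a i / (z - v i))) (𝓝[≠] v k) (𝓝 (a k)) := by
  classical
  have h0 : Tendsto (fun z => z - v k) (𝓝[≠] v k) (𝓝 0) := by
    have : Continuous fun z => z - v k := by fun_prop
    simpa using (this.tendsto (v k)).mono_left nhdsWithin_le_nhds
  have h1 : ContinuousAt (fun z => c + ∑ i ∈ Finset.univ.erase k, a i / (z - v i)) (v k) := by
    refine continuousAt_const.add (tendsto_finsetSum _ fun i hi => ?_)
    have : v k - v i ≠ 0 := sub_ne_zero.2 fun h => (Finset.ne_of_mem_erase hi) (hv h.symm)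
    exact ContinuousAt.div continuousAt_const (continuousAt_id.sub continuousAt_const) this
  have h2 := (h0.mul (h1.tendsto.mono_left nhdsWithin_le_nhds)).const_add (a k)
  rw [zero_mul, add_zero] at h2
  refine h2.congr' ?_
  filter_upwards [self_mem_nhdsWithin] with z hz
  have hz' : z - v k ≠ 0 := sub_ne_zero.2 hz
  rw [← Finset.add_sum_erase _ _ (Finset.mem_univ k)]
  field_simp
  ring

/-- The pole problem is solvable, and the solution has a potential. -/
lemma exists_isPoleRHSolution (S : Finset ℂ) (γ : ℂ → ℂ) (hS : ∀ p ∈ S, 0 < p.im) :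
    ∃ M, IsPoleRHSolution S γ M ∧ ∃ q, HasPotential M q := by
  have hv : Function.Injective fun p : S => (p : ℂ) := Subtype.val_injective
  have hv' : Function.Injective fun p : S => conj (p : ℂ) := (starRingEnd ℂ).injective.comp hv
  have hi : ∀ p : S, 0 < (p : ℂ).im := fun p => hS p p.2
  choose a b ha hb using fun i : Fin 2 => exists_residues (fun p : S => γ p) hv hi
    ((1 : Matrix (Fin 2) (Fin 2) ℂ) i 0) ((1 : Matrix (Fin 2) (Fin 2) ℂ) i 1)
  set M : ℂ → Matrix (Fin 2) (Fin 2) ℂ := fun z => Matrix.of fun i j =>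
    (1 : Matrix (Fin 2) (Fin 2) ℂ) i j + if j = 0 then ∑ p : S, a i p / (z - p)
      else ∑ p : S, b i p / (z - conj (p : ℂ)) with hM
  have hM0 : ∀ z i, M z i 0 = (1 : Matrix (Fin 2) (Fin 2) ℂ) i 0 + ∑ p : S, a i p / (z - p) :=
    fun z i => by simp [hM]
  have hM1 : ∀ z i, M z i 1 = (1 : Matrix (Fin 2) (Fin 2) ℂ) i 1 +
      ∑ p : S, b i p / (z - conj (p : ℂ)) := fun z i => by simp [hM]
  have hd0 : ∀ z i, (∀ p ∈ S, z ≠ p) → DifferentiableAt ℂ (fun z => M z i 0) z := by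
    intro z i hz
    simp only [hM0]
    exact (differentiableAt_const _).add (differentiableAt_sum_div _ fun p => hz p p.2)
  have hd1 : ∀ z i, (∀ p ∈ S, z ≠ conj p) → DifferentiableAt ℂ (fun z => M z i 1) z := by
    intro z i hz
    simp only [hM1]
    exact (differentiableAt_const _).add
      (differentiableAt_sum_div (v := fun p : S => conj (p : ℂ)) _ fun p => hz p p.2)
  have hd : ∀ z ∉ ((S : Set ℂ) ∪ conjSet S), ∀ i j, DifferentiableAt ℂ (fun z => M z i j) z := by
    intro z hz i j
    fin_cases j
    · exact hd0 z i fun p hp h => hz (Or.inl (h ▸ hp))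
    · refine hd1 z i fun p hp h => hz (Or.inr ?_)
      rw [h]
      simpa [conjSet] using hp
  have hpq : ∀ p ∈ S, ∀ q ∈ S, p ≠ conj q := fun p hp q hq h => by
    have h1 := congrArg Complex.im h
    rw [Complex.conj_im] at h1
    linarith [hS p hp, hS q hq]
  have hu : ∀ p ∈ S, HasResidueCondition p !![0, 0; γ p, 0] M := by
    intro p hp
    have hc : ∀ i, Tendsto (fun z => M z i 1) (𝓝[≠] p) (𝓝 (M p i 1)) := fun i =>
      (hd1 p i (hpq p hp)).continuousAt.tendsto.mono_left nhdsWithin_le_nhds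
    have h0 : Tendsto (fun z => z - p) (𝓝[≠] p) (𝓝 0) := by
      have : Continuous fun z => z - p := by fun_prop
      simpa using (this.tendsto p).mono_left nhdsWithin_le_nhds
    have hval : ∀ i, M p i 1 * γ p = a i ⟨p, hp⟩ := fun i => by
      rw [ha i ⟨p, hp⟩, hM1, mul_comm]
    refine ⟨Matrix.of fun i j => if j = 0 then a i ⟨p, hp⟩ else 0,
      tendsto_pi_nhds.2 fun i => tendsto_pi_nhds.2 fun j => ?_,
      tendsto_pi_nhds.2 fun i => tendsto_pi_nhds.2 fun j => ?_⟩
    · fin_cases j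
      · have := tendsto_sub_mul_sum_div hv (a i) ((1 : Matrix (Fin 2) (Fin 2) ℂ) i 0) ⟨p, hp⟩
        simpa [hM0] using this
      · have := h0.mul (hc i)
        rw [zero_mul] at this
        simpa using this
    · fin_cases j
      · have := (hc i).mul_const (γ p)
        rw [hval] at this
        simpa [Matrix.mul_apply] using this
      · simp [Matrix.mul_apply]
  have hl : ∀ p ∈ S, HasResidueCondition (conj p) !![0, -conj (γ p); 0, 0] M := by
    intro p hp
    have hc : ∀ i, Tendsto (fun z => M z i 0) (𝓝[≠] conj p) (𝓝 (M (conj p) i 0)) := fun i =>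
      (hd0 (conj p) i fun q hq => (hpq q hq p hp).symm).continuousAt.tendsto.mono_left
        nhdsWithin_le_nhds
    have h0 : Tendsto (fun z => z - conj p) (𝓝[≠] conj p) (𝓝 0) := by
      have : Continuous fun z => z - conj p := by fun_prop
      simpa using (this.tendsto (conj p)).mono_left nhdsWithin_le_nhds
    have hval : ∀ i, M (conj p) i 0 * -conj (γ p) = b i ⟨p, hp⟩ := fun i => by
      rw [hb i ⟨p, hp⟩, hM0, mul_comm]
    refine ⟨Matrix.of fun i j => if j = 0 then 0 else b i ⟨p, hp⟩,
      tendsto_pi_nhds.2 fun i => tendsto_pi_nhds.2 fun j => ?_,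
      tendsto_pi_nhds.2 fun i => tendsto_pi_nhds.2 fun j => ?_⟩
    · fin_cases j
      · have := h0.mul (hc i)
        rw [zero_mul] at this
        simpa using this
      · have := tendsto_sub_mul_sum_div hv' (b i) ((1 : Matrix (Fin 2) (Fin 2) ℂ) i 1) ⟨p, hp⟩
        simpa [hM1] using this
    · fin_cases j
      · simp [Matrix.mul_apply]
      · have := (hc i).mul_const (-conj (γ p))
        rw [hval] at this
        simpa [Matrix.mul_apply] using this
  have hasym : ∀ i j, (fun z => M z i j - (1 : Matrix (Fin 2) (Fin 2) ℂ) i j)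
      =O[Bornology.cobounded ℂ] fun z => z⁻¹ := by
    intro i j
    fin_cases j
    · refine (isBigO_sum_div (fun p : S => (p : ℂ)) (a i)).congr_left fun z => ?_
      change _ = M z i 0 - (1 : Matrix (Fin 2) (Fin 2) ℂ) i 0
      rw [hM0, add_sub_cancel_left]
    · refine (isBigO_sum_div (fun p : S => conj (p : ℂ)) (b i)).congr_left fun z => ?_
      change _ = M z i 1 - (1 : Matrix (Fin 2) (Fin 2) ℂ) i 1
      rw [hM1, add_sub_cancel_left]
  have hlim : ∀ i j, Tendsto (fun z => M z i j) (Bornology.cobounded ℂ)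
      (𝓝 ((1 : Matrix (Fin 2) (Fin 2) ℂ) i j)) := by
    intro i j
    have h1 := (hasym i j).trans_tendsto (tendsto_inv₀_cobounded (α := ℂ))
    simpa using h1.add_const ((1 : Matrix (Fin 2) (Fin 2) ℂ) i j)
  have hdet : ∀ z ∉ ((S : Set ℂ) ∪ conjSet S), (M z).det = 1 := by
    refine eq_of_finite_of_tendsto (f := fun z => (M z).det) (finite_poles S) ?_ ?_ ?_
    · intro z hz
      simp only [Matrix.det_fin_two]
      exact ((hd z hz 0 0).mul (hd z hz 1 1)).sub ((hd z hz 0 1).mul (hd z hz 1 0))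
    · intro s hs
      obtain ⟨R, hRR, hRdet, hR⟩ := exists_residueMatrix S γ hs
      obtain ⟨L, hL⟩ := (hasResidueCondition_iff hRR
        (eventually_punctured (finite_poles S) hd s)).1 (hR M hu hl)
      have hcont : Continuous fun A : Matrix (Fin 2) (Fin 2) ℂ => A.det :=
        continuous_id.matrix_det
      refine ⟨_, ((hcont.tendsto L).comp hL).congr fun z => ?_⟩
      simp only [Function.comp]
      rw [Matrix.det_mul, hRdet, mul_one]
    · have := ((hlim 0 0).mul (hlim 1 1)).sub ((hlim 0 1).mul (hlim 1 0))
      simpa [Matrix.det_fin_two] using this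
  refine ⟨M, ⟨⟨fun i j z hz => (hd z hz i j).differentiableWithinAt, hdet, hasym⟩, hu, hl⟩,
    2 * Complex.I * ∑ p : S, b 0 p, ?_⟩
  have := (tendsto_mul_sum_div (fun p : S => conj (p : ℂ)) (b 0)).const_mul (2 * Complex.I)
  simpa [HasPotential, hM1] using this

end Existence

/-! ### Passing between the jump problem and the pole problem -/

/-- The unbounded region outside the spectrum and its conjugate. -/
def exterior (U : Set ℂ) : Set ℂ := (closure U ∪ closure (conjSet U))ᶜ

/-- The contour `γ ∪ γ̄`. -/
def contour (U : Set ℂ) : Set ℂ := frontier U ∪ frontier (conjSet U)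

/-- The jump problem whose jump matrices are the rational functions determined by the poles `S`
with residue data `γ`. -/
structure IsJumpRHSolution (U : Set ℂ) (S : Finset ℂ) (γ : ℂ → ℂ)
    (M : ℂ → Matrix (Fin 2) (Fin 2) ℂ) : Prop where
  normalized : IsNormalized (contour U) M
  jump_upper : HasJump U (exterior U) (fun s => !![1, 0; poleSum S γ s, 1]) M
  jump_lower : HasJump (conjSet U) (exterior U)
    (fun s => !![1, -conj (poleSum S γ (conj s)); 0, 1]) M

open Classical in
/-- The triangular matrix that turns the poles inside the spectrum into a jump across its boundary:
the continuation of the jump matrix into `U` and `Ū`, and the identity elsewhere. -/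
def gasFactor (U : Set ℂ) (S : Finset ℂ) (γ : ℂ → ℂ) (z : ℂ) : Matrix (Fin 2) (Fin 2) ℂ :=
  if z ∈ U then !![1, 0; poleSum S γ z, 1]
  else if z ∈ conjSet U then !![1, -conj (poleSum S γ (conj z)); 0, 1]
  else 1

lemma lowerUnipotent_mul (a b : ℂ) : (!![1, 0; a, 1] * !![1, 0; b, 1] :
    Matrix (Fin 2) (Fin 2) ℂ) = !![1, 0; a + b, 1] := by
  ext i j; fin_cases i <;> fin_cases j <;> simp

lemma upperUnipotent_mul (a b : ℂ) : (!![1, a; 0, 1] * !![1, b; 0, 1] :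
    Matrix (Fin 2) (Fin 2) ℂ) = !![1, a + b; 0, 1] := by
  ext i j; fin_cases i <;> fin_cases j <;> simp [add_comm]

lemma lowerUnipotent_zero : (!![1, 0; 0, 1] : Matrix (Fin 2) (Fin 2) ℂ) = 1 :=
  Matrix.one_fin_two.symm

lemma continuous_lowerUnipotent :
    Continuous fun a : ℂ => (!![1, 0; a, 1] : Matrix (Fin 2) (Fin 2) ℂ) := by
  refine continuous_pi fun i => continuous_pi fun j => ?_
  fin_cases i <;> fin_cases j <;> simp <;> fun_prop

lemma continuous_upperUnipotent :
    Continuous fun a : ℂ => (!![1, a; 0, 1] : Matrix (Fin 2) (Fin 2) ℂ) := by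
  refine continuous_pi fun i => continuous_pi fun j => ?_
  fin_cases i <;> fin_cases j <;> simp <;> fun_prop

lemma poleSum_neg (S : Finset ℂ) (γ : ℂ → ℂ) (z : ℂ) :
    poleSum S (fun p => -γ p) z = -poleSum S γ z := by
  simp only [poleSum, neg_div, Finset.sum_neg_distrib]

lemma conj_poleSum_conj (S : Finset ℂ) (γ : ℂ → ℂ) (z : ℂ) :
    conj (poleSum S γ (conj z)) = ∑ p ∈ S, conj (γ p) / (conj p - z) := by
  simp only [poleSum, map_sum, map_div₀, map_sub, Complex.conj_conj]

lemma differentiableAt_poleSum {S : Finset ℂ} (γ : ℂ → ℂ) {z : ℂ} (hz : z ∉ S) :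
    DifferentiableAt ℂ (poleSum S γ) z :=
  DifferentiableAt.fun_sum fun _ hp => (differentiableAt_const _).div
    (differentiableAt_id.const_sub _) (sub_ne_zero.2 fun h => hz (h ▸ hp))

lemma differentiableAt_conj_poleSum_conj {S : Finset ℂ} (γ : ℂ → ℂ) {z : ℂ} (hz : conj z ∉ S) :
    DifferentiableAt ℂ (fun z => conj (poleSum S γ (conj z))) z := by
  simp only [conj_poleSum_conj]
  refine DifferentiableAt.fun_sum fun p hp => (differentiableAt_const _).div
    (differentiableAt_id.const_sub _) (sub_ne_zero.2 fun h => hz ?_)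
  rw [← h, Complex.conj_conj]
  exact hp

section Region

variable {U : Set ℂ} {S : Finset ℂ}

lemma isClosed_contour (U : Set ℂ) : IsClosed (contour U) :=
  isClosed_frontier.union isClosed_frontier

lemma isBounded_contour (hUb : Bornology.IsBounded U) : Bornology.IsBounded (contour U) :=
  (hUb.closure.subset frontier_subset_closure).union
    ((isBounded_conjSet hUb).closure.subset frontier_subset_closure)

lemma im_nonneg_of_mem_closure (hUu : U ⊆ upperHalf) {z : ℂ} (hz : z ∈ closure U) : 0 ≤ z.im :=
  closure_minimal (fun _ h => le_of_lt (hUu h))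
    (isClosed_le continuous_const Complex.continuous_im) hz

lemma im_nonpos_of_mem_closure_conjSet (hUu : U ⊆ upperHalf) {z : ℂ}
    (hz : z ∈ closure (conjSet U)) : z.im ≤ 0 := by
  rw [closure_conjSet] at hz
  have := im_nonneg_of_mem_closure hUu hz
  rw [Complex.conj_im] at this
  linarith

lemma im_neg_of_mem_conjSet (hUu : U ⊆ upperHalf) {z : ℂ} (hz : z ∈ conjSet U) : z.im < 0 := by
  have : 0 < (conj z).im := hUu hz
  rw [Complex.conj_im] at this
  linarith

lemma notMem_closure_conjSet (hUu : U ⊆ upperHalf) {z : ℂ} (hz : z ∈ U) :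
    z ∉ closure (conjSet U) := fun h => by
  have h1 : 0 < z.im := hUu hz
  linarith [im_nonpos_of_mem_closure_conjSet hUu h]

lemma notMem_closure_of_mem_conjSet (hUu : U ⊆ upperHalf) {z : ℂ} (hz : z ∈ conjSet U) :
    z ∉ closure U := fun h => by
  linarith [im_neg_of_mem_conjSet hUu hz, im_nonneg_of_mem_closure hUu h]

lemma notMem_contour_of_mem (hUo : IsOpen U) (hUu : U ⊆ upperHalf) {z : ℂ} (hz : z ∈ U) :
    z ∉ contour U := by
  rintro (h | h)
  · rw [hUo.frontier_eq] at h
    exact h.2 hz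
  · exact notMem_closure_conjSet hUu hz (frontier_subset_closure h)

lemma notMem_contour_of_mem_conjSet (hUo : IsOpen U) (hUu : U ⊆ upperHalf) {z : ℂ}
    (hz : z ∈ conjSet U) : z ∉ contour U := by
  rintro (h | h)
  · exact notMem_closure_of_mem_conjSet hUu hz (frontier_subset_closure h)
  · rw [(isOpen_conjSet hUo).frontier_eq] at h
    exact h.2 hz

lemma isOpen_exterior (U : Set ℂ) : IsOpen (exterior U) :=
  (isClosed_closure.union isClosed_closure).isOpen_compl

lemma notMem_contour_of_mem_exterior {z : ℂ} (hz : z ∈ exterior U) : z ∉ contour U := fun h =>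
  hz (h.imp (fun h => frontier_subset_closure h) fun h => frontier_subset_closure h)

lemma compl_contour_subset (hUo : IsOpen U) :
    (contour U)ᶜ ⊆ U ∪ (conjSet U ∪ exterior U) := by
  intro z hz
  by_cases h1 : z ∈ U
  · exact Or.inl h1
  by_cases h2 : z ∈ conjSet U
  · exact Or.inr (Or.inl h2)
  refine Or.inr (Or.inr ?_)
  rintro (h | h)
  · exact hz (Or.inl (by rw [hUo.frontier_eq]; exact ⟨h, h1⟩))
  · exact hz (Or.inr (by rw [(isOpen_conjSet hUo).frontier_eq]; exact ⟨h, h2⟩))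

/-- The exterior accumulates at the points where `γ` meets `γ̄`. Such a point is real, and the
contour meets the real line in a finite set. -/
lemma neBot_nhdsWithin_exterior (hUo : IsOpen U) (hUu : U ⊆ upperHalf)
    (hF : ContRemovable (contour U)) {s : ℂ} (h1 : s ∈ frontier U)
    (h2 : s ∈ frontier (conjSet U)) : (𝓝[exterior U] s).NeBot := by
  rw [← mem_closure_iff_nhdsWithin_neBot]
  have him : s.im = 0 := le_antisymm
    (im_nonpos_of_mem_closure_conjSet hUu (frontier_subset_closure h2))
    (im_nonneg_of_mem_closure hUu (frontier_subset_closure h1))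
  refine closure_mono ?_ (hF.mem_closure_line s)
  rintro _ ⟨x, hx, rfl⟩
  have him' : (s + (x : ℂ)).im = 0 := by simp [him]
  rcases compl_contour_subset hUo hx with h | h | h
  · have : 0 < (s + (x : ℂ)).im := hUu h
    linarith
  · linarith [im_neg_of_mem_conjSet hUu h]
  · exact h

lemma gasFactor_of_mem {γ : ℂ → ℂ} {z : ℂ} (hz : z ∈ U) :
    gasFactor U S γ z = !![1, 0; poleSum S γ z, 1] := if_pos hz

lemma gasFactor_of_mem_conjSet (hUu : U ⊆ upperHalf) {γ : ℂ → ℂ} {z : ℂ} (hz : z ∈ conjSet U) :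
    gasFactor U S γ z = !![1, -conj (poleSum S γ (conj z)); 0, 1] := by
  rw [gasFactor, if_neg fun h => notMem_closure_of_mem_conjSet hUu hz (subset_closure h), if_pos hz]

lemma gasFactor_of_notMem {γ : ℂ → ℂ} {z : ℂ} (h1 : z ∉ U) (h2 : z ∉ conjSet U) :
    gasFactor U S γ z = 1 := by
  rw [gasFactor, if_neg h1, if_neg h2]

lemma gasFactor_of_mem_exterior {γ : ℂ → ℂ} {z : ℂ} (hz : z ∈ exterior U) :
    gasFactor U S γ z = 1 :=
  gasFactor_of_notMem (fun h => hz (Or.inl (subset_closure h)))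
    fun h => hz (Or.inr (subset_closure h))

lemma gasFactor_neg_mul (U : Set ℂ) (S : Finset ℂ) (γ : ℂ → ℂ) (z : ℂ) :
    gasFactor U S (fun p => -γ p) z * gasFactor U S γ z = 1 := by
  unfold gasFactor
  split_ifs
  · rw [lowerUnipotent_mul, poleSum_neg, neg_add_cancel, lowerUnipotent_zero]
  · rw [upperUnipotent_mul, poleSum_neg, map_neg, neg_neg, add_neg_cancel, lowerUnipotent_zero]
  · exact mul_one 1

lemma det_gasFactor (U : Set ℂ) (S : Finset ℂ) (γ : ℂ → ℂ) (z : ℂ) :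
    (gasFactor U S γ z).det = 1 := by
  unfold gasFactor
  split_ifs <;> simp [Matrix.det_fin_two]

lemma differentiableAt_gasFactor (hUo : IsOpen U) (hUu : U ⊆ upperHalf) (γ : ℂ → ℂ) {z : ℂ}
    (hz : z ∉ ((S : Set ℂ) ∪ conjSet S) ∪ contour U) (i j : Fin 2) :
    DifferentiableAt ℂ (fun z => gasFactor U S γ z i j) z := by
  have hzS : z ∉ S := fun h => hz (Or.inl (Or.inl h))
  have hzS' : conj z ∉ S := fun h => hz (Or.inl (Or.inr h))
  rcases compl_contour_subset hUo (fun h => hz (Or.inr h)) with h | h | h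
  · have hev : (fun z => gasFactor U S γ z i j) =ᶠ[𝓝 z]
        fun z => (!![1, 0; poleSum S γ z, 1] : Matrix (Fin 2) (Fin 2) ℂ) i j := by
      filter_upwards [hUo.mem_nhds h] with w hw
      rw [gasFactor_of_mem hw]
    refine DifferentiableAt.congr_of_eventuallyEq ?_ hev
    have := differentiableAt_poleSum γ hzS
    fin_cases i <;> fin_cases j <;> simp
    exact this
  · have hev : (fun z => gasFactor U S γ z i j) =ᶠ[𝓝 z]
        fun z => (!![1, -conj (poleSum S γ (conj z)); 0, 1] : Matrix (Fin 2) (Fin 2) ℂ) i j := by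
      filter_upwards [(isOpen_conjSet hUo).mem_nhds h] with w hw
      rw [gasFactor_of_mem_conjSet hUu hw]
    refine DifferentiableAt.congr_of_eventuallyEq ?_ hev
    have := differentiableAt_conj_poleSum_conj γ hzS'
    fin_cases i <;> fin_cases j <;> simp
    exact this
  · have hev : (fun z => gasFactor U S γ z i j) =ᶠ[𝓝 z]
        fun _ => (1 : Matrix (Fin 2) (Fin 2) ℂ) i j := by
      filter_upwards [(isOpen_exterior U).mem_nhds h] with w hw
      rw [gasFactor_of_mem_exterior hw]
    exact (differentiableAt_const _).congr_of_eventuallyEq hev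

lemma IsNormalized.mul_gasFactor (hUo : IsOpen U) (hUb : Bornology.IsBounded U)
    (hUu : U ⊆ upperHalf) (γ : ℂ → ℂ) {M : ℂ → Matrix (Fin 2) (Fin 2) ℂ}
    (h : IsNormalized (((S : Set ℂ) ∪ conjSet S) ∪ contour U) M) :
    IsNormalized (((S : Set ℂ) ∪ conjSet S) ∪ contour U) (fun z => M z * gasFactor U S γ z) where
  analytic i j := fun z hz => by
    have hcl : IsClosed (((S : Set ℂ) ∪ conjSet S) ∪ contour U) :=
      (finite_poles S).isClosed.union (isClosed_contour U)
    simp only [Matrix.mul_apply]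
    exact (DifferentiableAt.fun_sum fun k _ => (h.differentiableAt hcl hz i k).mul
      (differentiableAt_gasFactor hUo hUu γ hz k j)).differentiableWithinAt
  det_eq_one z hz := by rw [Matrix.det_mul, h.det_eq_one z hz, det_gasFactor, one_mul]
  asymptotics i j := by
    refine (h.asymptotics i j).congr' ?_ EventuallyEq.rfl
    have : ∀ᶠ z in Bornology.cobounded ℂ, z ∈ (U ∪ conjSet U)ᶜ := hUb.union (isBounded_conjSet hUb)
    filter_upwards [this] with z hz
    rw [gasFactor_of_notMem (fun h => hz (Or.inl h)) fun h => hz (Or.inr h), mul_one]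

/-- At a pole, the factor `gasFactor` has the same effect as `1 - R / (z - p)`. -/
lemma hasResidueCondition_upper_iff (hUo : IsOpen U) {γ : ℂ → ℂ} {p : ℂ} (hpS : p ∈ S)
    (hpU : p ∈ U) {M : ℂ → Matrix (Fin 2) (Fin 2) ℂ}
    (hM : ∀ᶠ z in 𝓝[≠] p, ∀ i j, DifferentiableAt ℂ (fun z => M z i j) z) :
    HasResidueCondition p !![0, 0; γ p, 0] M ↔
      ∃ L, Tendsto (fun z => M z * gasFactor U S γ z) (𝓝[≠] p) (𝓝 L) := by
  rw [hasResidueCondition_iff (lowerResidue_mul_self _) hM]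
  have hc : ContinuousAt (poleSum (S.erase p) γ) p :=
    (differentiableAt_poleSum γ (Finset.notMem_erase p S)).continuousAt
  have hc' : ContinuousAt (poleSum (S.erase p) fun p => -γ p) p :=
    (differentiableAt_poleSum _ (Finset.notMem_erase p S)).continuousAt
  rw [exists_tendsto_mul_iff
    (((continuous_lowerUnipotent.tendsto _).comp hc.tendsto).mono_left nhdsWithin_le_nhds)
    (((continuous_lowerUnipotent.tendsto _).comp hc'.tendsto).mono_left nhdsWithin_le_nhds)
    (fun z => by
      simp only [Function.comp]
      rw [lowerUnipotent_mul, poleSum_neg, add_neg_cancel, lowerUnipotent_zero])]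
  refine exists_congr fun L => tendsto_congr' ?_
  filter_upwards [nhdsWithin_le_nhds (hUo.mem_nhds hpU)] with z hz
  rw [gasFactor_of_mem hz, mul_assoc]
  congr 1
  have h1 : (1 - (z - p)⁻¹ • !![0, 0; γ p, 0] : Matrix (Fin 2) (Fin 2) ℂ) =
      !![1, 0; γ p / (p - z), 1] := by
    have : γ p / (p - z) = -((z - p)⁻¹ * γ p) := by
      rw [← neg_sub, div_neg, div_eq_inv_mul]
    rw [this]
    ext i j; fin_cases i <;> fin_cases j <;> simp
  rw [h1]
  simp only [Function.comp]
  rw [lowerUnipotent_mul, poleSum, poleSum, Finset.add_sum_erase S (fun p => γ p / (p - z)) hpS]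

lemma hasResidueCondition_lower_iff (hUo : IsOpen U) (hUu : U ⊆ upperHalf) {γ : ℂ → ℂ} {p : ℂ}
    (hpS : p ∈ S) (hpU : p ∈ U) {M : ℂ → Matrix (Fin 2) (Fin 2) ℂ}
    (hM : ∀ᶠ z in 𝓝[≠] conj p, ∀ i j, DifferentiableAt ℂ (fun z => M z i j) z) :
    HasResidueCondition (conj p) !![0, -conj (γ p); 0, 0] M ↔
      ∃ L, Tendsto (fun z => M z * gasFactor U S γ z) (𝓝[≠] conj p) (𝓝 L) := by
  have hpU' : conj p ∈ conjSet U := by simpa [conjSet] using hpU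
  have hpe : conj (conj p) ∉ S.erase p := by
    rw [Complex.conj_conj]; exact Finset.notMem_erase p S
  rw [hasResidueCondition_iff (upperResidue_mul_self _) hM]
  have hc := (differentiableAt_conj_poleSum_conj γ hpe).continuousAt.neg
  have hc' := (differentiableAt_conj_poleSum_conj (fun p => -γ p) hpe).continuousAt.neg
  rw [exists_tendsto_mul_iff
    (((continuous_upperUnipotent.tendsto _).comp hc.tendsto).mono_left nhdsWithin_le_nhds)
    (((continuous_upperUnipotent.tendsto _).comp hc'.tendsto).mono_left nhdsWithin_le_nhds)
    (fun z => by
      simp only [Function.comp, Pi.neg_apply]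
      rw [upperUnipotent_mul, poleSum_neg, map_neg, add_neg_cancel, lowerUnipotent_zero])]
  refine exists_congr fun L => tendsto_congr' ?_
  filter_upwards [nhdsWithin_le_nhds ((isOpen_conjSet hUo).mem_nhds hpU')] with z hz
  rw [gasFactor_of_mem_conjSet hUu hz, mul_assoc]
  congr 1
  have h1 : (1 - (z - conj p)⁻¹ • !![0, -conj (γ p); 0, 0] : Matrix (Fin 2) (Fin 2) ℂ) =
      !![1, -(conj (γ p) / (conj p - z)); 0, 1] := by
    have : conj (γ p) / (conj p - z) = -((z - conj p)⁻¹ * conj (γ p)) := by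
      rw [← neg_sub, div_neg, div_eq_inv_mul]
    rw [this]
    ext i j; fin_cases i <;> fin_cases j <;> simp
  rw [h1]
  simp only [Function.comp, Pi.neg_apply]
  rw [upperUnipotent_mul, conj_poleSum_conj, conj_poleSum_conj, ← neg_add,
    Finset.add_sum_erase S (fun p => conj (γ p) / (conj p - z)) hpS]

/-- Points of the contour are not poles. -/
lemma notMem_poles_of_mem_contour (hUo : IsOpen U) (hUu : U ⊆ upperHalf) (hSU : ∀ p ∈ S, p ∈ U)
    {s : ℂ} (hs : s ∈ contour U) : s ∉ (S : Set ℂ) ∪ conjSet S := by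
  rintro (h | h)
  · exact notMem_contour_of_mem hUo hUu (hSU s h) hs
  · exact notMem_contour_of_mem_conjSet hUo hUu (hSU _ h) hs

/-- Removing the jump: dividing a solution of the jump problem by `gasFactor` gives a matrix that is
continuous across the contour, hence holomorphic there, and has poles at `S`. -/
lemma IsJumpRHSolution.exists_isPoleRHSolution (hUo : IsOpen U) (hUb : Bornology.IsBounded U)
    (hUu : U ⊆ upperHalf) (hSU : ∀ p ∈ S, p ∈ U) (hF : ContRemovable (contour U)) {γ : ℂ → ℂ}
    {M : ℂ → Matrix (Fin 2) (Fin 2) ℂ} (h : IsJumpRHSolution U S γ M) {q : ℂ}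
    (hq : HasPotential M q) : ∃ M', IsPoleRHSolution S γ M' ∧ HasPotential M' q := by
  set N : ℂ → Matrix (Fin 2) (Fin 2) ℂ := fun z => M z * gasFactor U S (fun p => -γ p) z with hN
  have hNn : IsNormalized (((S : Set ℂ) ∪ conjSet S) ∪ contour U) N :=
    (h.normalized.mono Set.subset_union_right).mul_gasFactor hUo hUb hUu _
  have hext : ∀ {s : ℂ} {B : Matrix (Fin 2) (Fin 2) ℂ}, Tendsto M (𝓝[exterior U] s) (𝓝 B) →
      Tendsto N (𝓝[exterior U] s) (𝓝 B) := fun hB => by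
    refine hB.congr' ?_
    filter_upwards [self_mem_nhdsWithin] with z hz
    rw [hN]
    simp only
    rw [gasFactor_of_mem_exterior hz, mul_one]
  have hup : ∀ s ∈ frontier U, ∃ B, Tendsto N (𝓝[U] s) (𝓝 B) ∧
      Tendsto N (𝓝[exterior U] s) (𝓝 B) := by
    intro s hs
    obtain ⟨A, B, hA, hB, hAB⟩ := h.jump_upper s hs
    have hsS : s ∉ S := fun hp =>
      notMem_poles_of_mem_contour hUo hUu hSU (Or.inl hs) (Or.inl hp)
    refine ⟨B, ?_, hext hB⟩
    have hc := (differentiableAt_poleSum (fun p => -γ p) hsS).continuousAt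
    have h1 := hA.mul
      (((continuous_lowerUnipotent.tendsto _).comp hc.tendsto).mono_left nhdsWithin_le_nhds)
    rw [hAB, mul_assoc, lowerUnipotent_mul, poleSum_neg, add_neg_cancel, lowerUnipotent_zero,
      mul_one] at h1
    refine h1.congr' ?_
    filter_upwards [self_mem_nhdsWithin] with z hz
    simp only [hN, Function.comp]
    rw [gasFactor_of_mem hz]
  have hlow : ∀ s ∈ frontier (conjSet U), ∃ B, Tendsto N (𝓝[conjSet U] s) (𝓝 B) ∧
      Tendsto N (𝓝[exterior U] s) (𝓝 B) := by
    intro s hs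
    obtain ⟨A, B, hA, hB, hAB⟩ := h.jump_lower s hs
    have hsS : conj s ∉ S := fun hp =>
      notMem_poles_of_mem_contour hUo hUu hSU (Or.inr hs) (Or.inr hp)
    refine ⟨B, ?_, hext hB⟩
    have hc := (differentiableAt_conj_poleSum_conj (fun p => -γ p) hsS).continuousAt.neg
    have h1 := hA.mul
      (((continuous_upperUnipotent.tendsto _).comp hc.tendsto).mono_left nhdsWithin_le_nhds)
    simp only [Pi.neg_apply] at h1
    rw [hAB, mul_assoc, upperUnipotent_mul, poleSum_neg, map_neg, add_neg_cancel,
      lowerUnipotent_zero, mul_one] at h1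
    refine h1.congr' ?_
    filter_upwards [self_mem_nhdsWithin] with z hz
    simp only [hN, Function.comp, Pi.neg_apply]
    rw [gasFactor_of_mem_conjSet hUu hz]
  have hlim : ∀ s ∈ contour U, s ∉ ((S : Set ℂ) ∪ conjSet S) →
      ∃ L, Tendsto N (𝓝[(contour U)ᶜ] s) (𝓝 L) := by
    intro s hs _
    suffices ∃ L, Tendsto N (𝓝[U] s) (𝓝 L) ∧ Tendsto N (𝓝[conjSet U] s) (𝓝 L) ∧
        Tendsto N (𝓝[exterior U] s) (𝓝 L) by
      obtain ⟨L, h1, h2, h3⟩ := this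
      refine ⟨L, Tendsto.mono_left ?_ (nhdsWithin_mono s (compl_contour_subset hUo))⟩
      rw [nhdsWithin_union, nhdsWithin_union]
      exact h1.sup (h2.sup h3)
    by_cases h1 : s ∈ frontier U
    · obtain ⟨B₁, hU₁, hW₁⟩ := hup s h1
      by_cases h2 : s ∈ frontier (conjSet U)
      · obtain ⟨B₂, hU₂, hW₂⟩ := hlow s h2
        have := neBot_nhdsWithin_exterior hUo hUu hF h1 h2
        have hB := tendsto_nhds_unique hW₁ hW₂
        exact ⟨B₁, hU₁, hB ▸ hU₂, hW₁⟩
      · have hbot : 𝓝[conjSet U] s = ⊥ := by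
          rw [← notMem_closure_iff_nhdsWithin_eq_bot]
          intro hc
          refine h2 ?_
          rw [(isOpen_conjSet hUo).frontier_eq]
          exact ⟨hc, fun hm => notMem_closure_of_mem_conjSet hUu hm (frontier_subset_closure h1)⟩
        exact ⟨B₁, hU₁, by rw [hbot]; exact tendsto_bot, hW₁⟩
    · have h2 : s ∈ frontier (conjSet U) := hs.resolve_left h1
      obtain ⟨B₂, hU₂, hW₂⟩ := hlow s h2
      have hbot : 𝓝[U] s = ⊥ := by
        rw [← notMem_closure_iff_nhdsWithin_eq_bot]
        intro hc
        refine h1 ?_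
        rw [hUo.frontier_eq]
        exact ⟨hc, fun hm => notMem_closure_conjSet hUu hm (frontier_subset_closure h2)⟩
      exact ⟨B₂, by rw [hbot]; exact tendsto_bot, hU₂, hW₂⟩
  obtain ⟨M', hM', heq⟩ := hNn.extend (finite_poles S).isClosed (finite_poles S).isBounded hF
    (isBounded_contour hUb) hlim
  have hd : ∀ s, ∀ᶠ z in 𝓝[≠] s, ∀ i j, DifferentiableAt ℂ (fun z => M' z i j) z := fun s =>
    eventually_punctured (finite_poles S)
      (fun z hz => hM'.differentiableAt (finite_poles S).isClosed hz) s
  -- near a pole, `M' * gasFactor` is the given solution `M`, which is holomorphic there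
  have hpole : ∀ s ∉ contour U,
      ∃ L, Tendsto (fun z => M' z * gasFactor U S γ z) (𝓝[≠] s) (𝓝 L) := by
    intro s hs
    refine ⟨M s, ((h.normalized.continuousAt (isClosed_contour U) hs).tendsto.mono_left
      nhdsWithin_le_nhds).congr' ?_⟩
    filter_upwards [nhdsWithin_le_nhds ((isClosed_contour U).isOpen_compl.mem_nhds hs),
      eventually_punctured (finite_poles S) (fun z hz => hz) s] with z hz hzS
    rw [heq z fun h => h.elim hzS hz, hN]
    simp only
    rw [mul_assoc, gasFactor_neg_mul, mul_one]
  refine ⟨M', ⟨hM', fun p hp => ?_, fun p hp => ?_⟩, ?_⟩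
  · exact (hasResidueCondition_upper_iff hUo hp (hSU p hp) (hd p)).2
      (hpole p (notMem_contour_of_mem hUo hUu (hSU p hp)))
  · refine (hasResidueCondition_lower_iff hUo hUu hp (hSU p hp) (hd _)).2
      (hpole _ (notMem_contour_of_mem_conjSet hUo hUu ?_))
    simpa [conjSet] using hSU p hp
  · refine hq.congr (B := (U ∪ conjSet U) ∪ (((S : Set ℂ) ∪ conjSet S) ∪ contour U))
      ((hUb.union (isBounded_conjSet hUb)).union
        ((finite_poles S).isBounded.union (isBounded_contour hUb))) fun z hz => ?_
    rw [heq z fun h => hz (Or.inr h), hN]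
    simp only
    rw [gasFactor_of_notMem (fun h => hz (Or.inl (Or.inl h))) fun h => hz (Or.inl (Or.inr h)),
      mul_one]

/-- Trading the poles for a jump: the product of a solution of the pole problem with `gasFactor` is
holomorphic inside the spectrum. -/
lemma IsPoleRHSolution.exists_isJumpRHSolution (hUo : IsOpen U) (hUb : Bornology.IsBounded U)
    (hUu : U ⊆ upperHalf) (hSU : ∀ p ∈ S, p ∈ U) {γ : ℂ → ℂ}
    {M : ℂ → Matrix (Fin 2) (Fin 2) ℂ} (h : IsPoleRHSolution S γ M) {q : ℂ}
    (hq : HasPotential M q) : ∃ M', IsJumpRHSolution U S γ M' ∧ HasPotential M' q := by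
  have hP := finite_poles S
  set N : ℂ → Matrix (Fin 2) (Fin 2) ℂ := fun z => M z * gasFactor U S γ z with hN
  have hNn : IsNormalized (contour U ∪ ((S : Set ℂ) ∪ conjSet S)) N := by
    rw [Set.union_comm]
    exact (h.normalized.mono Set.subset_union_left).mul_gasFactor hUo hUb hUu _
  have hd : ∀ s, ∀ᶠ z in 𝓝[≠] s, ∀ i j, DifferentiableAt ℂ (fun z => M z i j) z := fun s =>
    eventually_punctured hP (fun z hz => h.normalized.differentiableAt hP.isClosed hz) s
  obtain ⟨M', hM', heq⟩ := hNn.extend (isClosed_contour U) (isBounded_contour hUb)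
    (ContRemovable.of_finite hP) hP.isBounded (by
      intro s hs _
      suffices ∃ L, Tendsto N (𝓝[≠] s) (𝓝 L) by
        obtain ⟨L, hL⟩ := this
        exact ⟨L, hL.mono_left (nhdsWithin_mono s fun z hz hzs => hz (by
          rw [Set.mem_singleton_iff.1 hzs]; exact hs))⟩
      rcases hs with hs | hs
      · exact (hasResidueCondition_upper_iff hUo hs (hSU s hs) (hd s)).1 (h.residue_upper s hs)
      · have h1 := (hasResidueCondition_lower_iff hUo hUu hs (hSU _ hs) (hd _)).1
          (h.residue_lower (conj s) hs)
        rwa [Complex.conj_conj] at h1)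
  have hext : ∀ s ∈ contour U, Tendsto M' (𝓝[exterior U] s) (𝓝 (M s)) := by
    intro s hs
    refine ((h.normalized.continuousAt hP.isClosed
      (notMem_poles_of_mem_contour hUo hUu hSU hs)).tendsto.mono_left nhdsWithin_le_nhds).congr' ?_
    filter_upwards [self_mem_nhdsWithin, nhdsWithin_le_nhds (hP.isClosed.isOpen_compl.mem_nhds
      (notMem_poles_of_mem_contour hUo hUu hSU hs))] with z hz hzS
    rw [heq z fun h => h.elim (notMem_contour_of_mem_exterior hz) hzS]
    simp only [hN]
    rw [gasFactor_of_mem_exterior hz, mul_one]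
  refine ⟨M', ⟨hM', fun s hs => ?_, fun s hs => ?_⟩, ?_⟩
  · have hsP := notMem_poles_of_mem_contour hUo hUu hSU (Or.inl hs)
    have hc := (differentiableAt_poleSum γ fun hp => hsP (Or.inl hp)).continuousAt
    refine ⟨_, M s, ?_, hext s (Or.inl hs), rfl⟩
    refine (((h.normalized.continuousAt hP.isClosed hsP).tendsto.mono_left
      nhdsWithin_le_nhds).mul (((continuous_lowerUnipotent.tendsto _).comp
        hc.tendsto).mono_left nhdsWithin_le_nhds)).congr' ?_
    filter_upwards [self_mem_nhdsWithin,
      nhdsWithin_le_nhds (hP.isClosed.isOpen_compl.mem_nhds hsP)] with z hz hzS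
    rw [heq z fun h => h.elim (notMem_contour_of_mem hUo hUu hz) hzS]
    simp only [hN, Function.comp]
    rw [gasFactor_of_mem hz]
  · have hsP := notMem_poles_of_mem_contour hUo hUu hSU (Or.inr hs)
    have hc := (differentiableAt_conj_poleSum_conj γ fun hp => hsP (Or.inr hp)).continuousAt.neg
    refine ⟨_, M s, ?_, hext s (Or.inr hs), rfl⟩
    refine (((h.normalized.continuousAt hP.isClosed hsP).tendsto.mono_left
      nhdsWithin_le_nhds).mul (((continuous_upperUnipotent.tendsto _).comp
        hc.tendsto).mono_left nhdsWithin_le_nhds)).congr' ?_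
    filter_upwards [self_mem_nhdsWithin,
      nhdsWithin_le_nhds (hP.isClosed.isOpen_compl.mem_nhds hsP)] with z hz hzS
    rw [heq z fun h => h.elim (notMem_contour_of_mem_conjSet hUo hUu hz) hzS]
    simp only [hN, Function.comp, Pi.neg_apply]
    rw [gasFactor_of_mem_conjSet hUu hz]
  · refine hq.congr (B := (U ∪ conjSet U) ∪ (((S : Set ℂ) ∪ conjSet S) ∪ contour U))
      ((hUb.union (isBounded_conjSet hUb)).union
        (hP.isBounded.union (isBounded_contour hUb))) fun z hz => ?_
    rw [heq z fun h => hz (Or.inr h.symm), hN]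
    simp only
    rw [gasFactor_of_notMem (fun h => hz (Or.inl (Or.inl h))) fun h => hz (Or.inl (Or.inr h)),
      mul_one]

end Region

/-! ### The gas and its shielded counterpart -/

lemma contRemovable_frontier_quadratureDomain (m : ℕ) (a b : ℂ) {ρ : ℝ} (hρ : 0 < ρ) :
    ContRemovable (frontier (quadratureDomain m a b ρ)) := by
  rcases Nat.eq_zero_or_pos m with rfl | hm
  · rw [quadratureDomain_zero, frontier_empty]
    exact ContRemovable.empty
  · refine (contRemovable_lemniscate hm a b hρ).mono isClosed_frontier ?_
    have h : quadratureDomain m a b ρ = {z | ‖(z - a) ^ m - b‖ < ρ} := by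
      ext z
      exact and_iff_right hm
    rw [h]
    exact frontier_lt_subset_eq (by fun_prop) continuous_const

lemma ContRemovable.frontier_union {A B : Set ℂ} (hA : ContRemovable (frontier A))
    (hB : ContRemovable (frontier B)) : ContRemovable (frontier (A ∪ B)) :=
  (hA.union hB).mono isClosed_frontier
    ((frontier_union_subset A B).trans
      (Set.union_subset_union Set.inter_subset_left Set.inter_subset_right))

section Gas

variable {N₁ N₂ : ℕ} {d₀ d₁ : ℂ} {ρ : ℝ}

lemma isOpen_gasRegion (N₁ N₂ : ℕ) (d₀ d₁ : ℂ) (ρ : ℝ) :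
    IsOpen (gasRegion (quadratureDomain N₁ d₀ d₁ ρ) (quadratureDomain N₂ d₀ d₁ ρ)) := by
  rw [gasRegion, mirror_quadratureDomain]
  exact ((isOpen_quadratureDomain _ _ _ _).union (isOpen_quadratureDomain _ _ _ _)).union
    (isOpen_quadratureDomain _ _ _ _)

lemma isBounded_gasRegion (N₁ N₂ : ℕ) (d₀ d₁ : ℂ) (ρ : ℝ) :
    Bornology.IsBounded
      (gasRegion (quadratureDomain N₁ d₀ d₁ ρ) (quadratureDomain N₂ d₀ d₁ ρ)) := by
  rw [gasRegion, mirror_quadratureDomain]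
  exact ((isBounded_quadratureDomain _ _ _ _).union (isBounded_quadratureDomain _ _ _ _)).union
    (isBounded_quadratureDomain _ _ _ _)

lemma gasRegion_subset_upperHalf {D₁ D₂ : Set ℂ} (h₁ : D₁ ⊆ upperHalf) (h₂ : D₂ ⊆ upperHalf) :
    gasRegion D₁ D₂ ⊆ upperHalf := by
  refine Set.union_subset (Set.union_subset h₁ fun w hw => ?_) h₂
  have : 0 < (-conj w).im := h₁ hw
  simpa [upperHalf] using this

lemma contRemovable_contour_gasRegion (N₁ N₂ : ℕ) (d₀ d₁ : ℂ) (hρ : 0 < ρ) :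
    ContRemovable (contour
      (gasRegion (quadratureDomain N₁ d₀ d₁ ρ) (quadratureDomain N₂ d₀ d₁ ρ))) := by
  have h := fun m a b => contRemovable_frontier_quadratureDomain m a b hρ
  have hconj : conjSet (gasRegion (quadratureDomain N₁ d₀ d₁ ρ) (quadratureDomain N₂ d₀ d₁ ρ)) =
      conjSet (quadratureDomain N₁ d₀ d₁ ρ) ∪ conjSet (mirror (quadratureDomain N₁ d₀ d₁ ρ)) ∪
        conjSet (quadratureDomain N₂ d₀ d₁ ρ) := rfl
  refine ContRemovable.union ?_ ?_
  · rw [gasRegion, mirror_quadratureDomain]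
    exact ((h _ _ _).frontier_union (h _ _ _)).frontier_union (h _ _ _)
  · rw [hconj, mirror_quadratureDomain]
    simp only [conjSet_quadratureDomain]
    exact ((h _ _ _).frontier_union (h _ _ _)).frontier_union (h _ _ _)

lemma upperPoles_subset_gasRegion (hρ : 0 < ρ) {z : Fin N₁ → ℂ} {κ : Fin N₂ → ℂ}
    (hzr : ∀ k, (z k - d₀) ^ N₁ = d₁) (hκr : ∀ j, (κ j - d₀) ^ N₂ = d₁) :
    upperPoles z κ ⊆ gasRegion (quadratureDomain N₁ d₀ d₁ ρ) (quadratureDomain N₂ d₀ d₁ ρ) := by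
  have hz : ∀ k, z k ∈ quadratureDomain N₁ d₀ d₁ ρ := fun k =>
    ⟨k.pos, by rw [hzr k]; simpa using hρ⟩
  rintro p ((⟨k, rfl⟩ | ⟨k, rfl⟩) | ⟨j, rfl⟩)
  · exact Or.inl (Or.inl (hz k))
  · refine Or.inl (Or.inr ?_)
    simpa [mirror] using hz k
  · exact Or.inr ⟨j.pos, by rw [hκr j]; simpa using hρ⟩

/-- The multi-soliton problem is the pole problem with the phases absorbed in the constants. -/
lemma isSolitonRHSolution_iff (x t : ℝ) (z c : Fin N₁ → ℂ) (κ h : Fin N₂ → ℂ)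
    (M : ℂ → Matrix (Fin 2) (Fin 2) ℂ) :
    IsSolitonRHSolution x t z c κ h M ↔
      IsPoleRHSolution (finite_upperPoles z κ).toFinset (phasedConstant x t z c κ h) M := by
  have hlow : ∀ p, conj (normingConstant z c κ h p)
      * Complex.exp (-(2 * Complex.I * phase x t (conj p))) =
      conj (phasedConstant x t z c κ h p) := fun p => by
    rw [phasedConstant, map_mul, conj_exp_phase]
  constructor
  · rintro ⟨h1, h2, h3⟩
    simp only [hlow] at h3
    refine ⟨by rwa [Set.Finite.coe_toFinset], fun p hp => h2 p ?_, fun p hp => h3 p ?_⟩ <;>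
      simpa using hp
  · rintro ⟨h1, h2, h3⟩
    refine ⟨by rwa [Set.Finite.coe_toFinset] at h1, fun p hp => h2 p (by simpa using hp), ?_⟩
    simp only [hlow]
    exact fun p hp => h3 p (by simpa using hp)

lemma hasJump_congr {U W : Set ℂ} {V V' M : ℂ → Matrix (Fin 2) (Fin 2) ℂ}
    (h : ∀ s ∈ frontier U, V s = V' s) : HasJump U W V M ↔ HasJump U W V' M :=
  forall₂_congr fun s hs => by rw [h s hs]

/-- The gas problem is the jump problem of its shielded poles, by the quadrature identity. -/
lemma isGasRHSolution_iff (x t : ℝ) (hd₁ : d₁ ≠ 0) (hρ : 0 < ρ)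
    (hU : gasRegion (quadratureDomain N₁ d₀ d₁ ρ) (quadratureDomain N₂ d₀ d₁ ρ) ⊆ upperHalf)
    {ϖ₁ ϖ₂ : ℂ → ℂ} (hϖ₁ : DiffContOnCl ℂ ϖ₁ (quadratureDomain N₁ d₀ d₁ ρ))
    (hϖ₂ : DiffContOnCl ℂ ϖ₂ (quadratureDomain N₂ d₀ d₁ ρ))
    {z : Fin N₁ → ℂ} {κ : Fin N₂ → ℂ} (hz : Function.Injective z)
    (hzr : ∀ k, (z k - d₀) ^ N₁ = d₁) (hκ : Function.Injective κ)
    (hκr : ∀ j, (κ j - d₀) ^ N₂ = d₁) (M : ℂ → Matrix (Fin 2) (Fin 2) ℂ) :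
    IsGasRHSolution x t (quadratureDomain N₁ d₀ d₁ ρ) (density N₁ d₀ ϖ₁)
        (quadratureDomain N₂ d₀ d₁ ρ) (density N₂ d₀ ϖ₂) M ↔
      IsJumpRHSolution (gasRegion (quadratureDomain N₁ d₀ d₁ ρ) (quadratureDomain N₂ d₀ d₁ ρ))
        (finite_upperPoles z κ).toFinset
        (phasedConstant x t z (shieldedConstant ρ ϖ₁ z) κ (shieldedConstant ρ ϖ₂ κ)) M := by
  have hUo := isOpen_gasRegion N₁ N₂ d₀ d₁ ρ
  have hup : ∀ s ∈ frontier (gasRegion (quadratureDomain N₁ d₀ d₁ ρ)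
      (quadratureDomain N₂ d₀ d₁ ρ)), s ∉ gasRegion (quadratureDomain N₁ d₀ d₁ ρ)
      (quadratureDomain N₂ d₀ d₁ ρ) := fun s hs hm =>
    notMem_contour_of_mem hUo hU hm (Or.inl hs)
  have hlow : ∀ s ∈ frontier (conjSet (gasRegion (quadratureDomain N₁ d₀ d₁ ρ)
      (quadratureDomain N₂ d₀ d₁ ρ))), conj s ∉ gasRegion (quadratureDomain N₁ d₀ d₁ ρ)
      (quadratureDomain N₂ d₀ d₁ ρ) := fun s hs hm =>
    notMem_contour_of_mem_conjSet hUo hU (z := s) hm (Or.inr hs)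
  have e1 := hasJump_congr (W := exterior (gasRegion (quadratureDomain N₁ d₀ d₁ ρ)
      (quadratureDomain N₂ d₀ d₁ ρ))) (M := M)
      (V := upperJump x t (quadratureDomain N₁ d₀ d₁ ρ) (density N₁ d₀ ϖ₁)
        (quadratureDomain N₂ d₀ d₁ ρ) (density N₂ d₀ ϖ₂)) fun s hs => by
    rw [upperJump, upperJump_entry x t hd₁ hρ hϖ₁ hϖ₂ hz hzr hκ hκr (hup s hs)]
  have e2 := hasJump_congr (W := exterior (gasRegion (quadratureDomain N₁ d₀ d₁ ρ)
      (quadratureDomain N₂ d₀ d₁ ρ))) (M := M)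
      (V := lowerJump x t (quadratureDomain N₁ d₀ d₁ ρ) (density N₁ d₀ ϖ₁)
        (quadratureDomain N₂ d₀ d₁ ρ) (density N₂ d₀ ϖ₂)) fun s hs => by
    rw [lowerJump, lowerJump_entry,
      upperJump_entry x t hd₁ hρ hϖ₁ hϖ₂ hz hzr hκ hκr (hlow s hs)]
  exact ⟨fun h => ⟨h.normalized, e1.1 h.jump_upper, e2.1 h.jump_lower⟩,
    fun h => ⟨h.normalized, e1.2 h.jump_upper, e2.2 h.jump_lower⟩⟩

end Gas

/-- The jump problem and the pole problem have the same, unique potential. -/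
lemma existsUnique_potential {U : Set ℂ} {S : Finset ℂ} (hUo : IsOpen U)
    (hUb : Bornology.IsBounded U) (hUu : U ⊆ upperHalf) (hSU : ∀ p ∈ S, p ∈ U)
    (hF : ContRemovable (contour U)) (γ : ℂ → ℂ) :
    ∃ q₀ : ℂ, (∀ q, (∃ M, IsJumpRHSolution U S γ M ∧ HasPotential M q) ↔ q = q₀) ∧
      ∀ q, (∃ M, IsPoleRHSolution S γ M ∧ HasPotential M q) ↔ q = q₀ := by
  obtain ⟨M₀, hM₀, q₀, hq₀⟩ := exists_isPoleRHSolution S γ fun p hp => hUu (hSU p hp)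
  have huniq : ∀ q M, IsPoleRHSolution S γ M → HasPotential M q → q = q₀ := fun q M hM hq =>
    tendsto_nhds_unique (hq.congr (finite_poles S).isBounded (hM.unique hM₀)) hq₀
  refine ⟨q₀, fun q => ⟨?_, ?_⟩, fun q => ⟨?_, ?_⟩⟩
  · rintro ⟨M, hM, hq⟩
    obtain ⟨M', hM', hq'⟩ := hM.exists_isPoleRHSolution hUo hUb hUu hSU hF hq
    exact huniq q M' hM' hq'
  · rintro rfl
    exact hM₀.exists_isJumpRHSolution hUo hUb hUu hSU hq₀
  · rintro ⟨M, hM, hq⟩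
    exact huniq q M hM hq
  · rintro rfl
    exact ⟨M₀, hM₀, hq₀⟩

end MKdVGas

end

theorem theorem1p1 (N₁ N₂ : ℕ) (d₀ d₁ : ℂ) (ρ : ℝ)
    (hd₀ : d₀ ∈ MKdVGas.upperHalf) (hd₁ : d₁ ≠ 0) (hρ : 0 < ρ)
    (hD₁ : MKdVGas.quadratureDomain N₁ d₀ d₁ ρ ⊆ MKdVGas.upperHalf)
    (hD₂ : MKdVGas.quadratureDomain N₂ d₀ d₁ ρ ⊆ MKdVGas.upperHalf)
    (ϖ₁ ϖ₂ : ℂ → ℂ)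
    (hϖ₁ : DiffContOnCl ℂ ϖ₁ (MKdVGas.quadratureDomain N₁ d₀ d₁ ρ))
    (hϖ₂ : DiffContOnCl ℂ ϖ₂ (MKdVGas.quadratureDomain N₂ d₀ d₁ ρ))
    (z : Fin N₁ → ℂ) (hz : Function.Injective z) (hz_root : ∀ k, (z k - d₀) ^ N₁ = d₁)
    (κ : Fin N₂ → ℂ) (hκ : Function.Injective κ) (hκ_root : ∀ j, (κ j - d₀) ^ N₂ = d₁) :
    (∃! q : ℝ → ℝ → ℂ, MKdVGas.IsGasSolution
      (MKdVGas.quadratureDomain N₁ d₀ d₁ ρ) (MKdVGas.density N₁ d₀ ϖ₁)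
      (MKdVGas.quadratureDomain N₂ d₀ d₁ ρ) (MKdVGas.density N₂ d₀ ϖ₂) q) ∧
    ∀ q : ℝ → ℝ → ℂ,
      MKdVGas.IsGasSolution
        (MKdVGas.quadratureDomain N₁ d₀ d₁ ρ) (MKdVGas.density N₁ d₀ ϖ₁)
        (MKdVGas.quadratureDomain N₂ d₀ d₁ ρ) (MKdVGas.density N₂ d₀ ϖ₂) q ↔
      MKdVGas.IsSolitonSolution
        z (MKdVGas.shieldedConstant ρ ϖ₁ z) κ (MKdVGas.shieldedConstant ρ ϖ₂ κ) q := by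
  have hU := MKdVGas.gasRegion_subset_upperHalf hD₁ hD₂
  choose q₀ hgas hsol using fun x t : ℝ => MKdVGas.existsUnique_potential
    (MKdVGas.isOpen_gasRegion N₁ N₂ d₀ d₁ ρ) (MKdVGas.isBounded_gasRegion N₁ N₂ d₀ d₁ ρ) hU
    (S := (MKdVGas.finite_upperPoles z κ).toFinset)
    (fun p hp => MKdVGas.upperPoles_subset_gasRegion hρ hz_root hκ_root (by simpa using hp))
    (MKdVGas.contRemovable_contour_gasRegion N₁ N₂ d₀ d₁ hρ)
    (MKdVGas.phasedConstant x t z (MKdVGas.shieldedConstant ρ ϖ₁ z) κ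
      (MKdVGas.shieldedConstant ρ ϖ₂ κ))
  have hg : ∀ q : ℝ → ℝ → ℂ, MKdVGas.IsGasSolution
      (MKdVGas.quadratureDomain N₁ d₀ d₁ ρ) (MKdVGas.density N₁ d₀ ϖ₁)
      (MKdVGas.quadratureDomain N₂ d₀ d₁ ρ) (MKdVGas.density N₂ d₀ ϖ₂) q ↔ q = q₀ := by
    intro q
    simp only [MKdVGas.IsGasSolution,
      MKdVGas.isGasRHSolution_iff _ _ hd₁ hρ hU hϖ₁ hϖ₂ hz hz_root hκ hκ_root, hgas, funext_iff]
  have hs : ∀ q : ℝ → ℝ → ℂ, MKdVGas.IsSolitonSolution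
      z (MKdVGas.shieldedConstant ρ ϖ₁ z) κ (MKdVGas.shieldedConstant ρ ϖ₂ κ) q ↔ q = q₀ := by
    intro q
    simp only [MKdVGas.IsSolitonSolution, MKdVGas.isSolitonRHSolution_iff, hsol, funext_iff]
  exact ⟨⟨q₀, (hg q₀).2 rfl, fun q hq => (hg q).1 hq⟩, fun q => (hg q).trans (hs q).symm⟩
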